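/- Fix $\hbar>0$, $n\ge 0$, and let $H(z,t)$ be a real (possibly time-dependent) Hamiltonian of class $C^2$ on $\mathbb R^{2n}\times\mathbb R$, $z=(x,p)$. Let $I\ni 0$ be an open interval on which the solution $t\mapsto f_t(z_0)$ of Hamilton's equations $\dot x=\partial_pH$, $\dot p=-\partial_xH$, $f_0(z_0)=z_0$, exists. Let $(f_t)$ be the Hamiltonian flow near this orbit and let $S_t=S_t(z_0)=Df_t(z_0)=\begin{pmatrix}A_t&B_t\\ C_t&D_t\end{pmatrix}$ be its Jacobian matrix. Put $\sigma(z,z')=p\cdot x'-p'\cdot x$, let $$\widehat T(z_0)\psi(x)=e^{\frac i\hbar(p_0\cdot x-\frac12p_0\cdot x_0)}\psi(x-x_0)$$ be the Heisenberg--Weyl operators on $L^2(\mathbb R^n)$, and let $\pi:\mathrm{Mp}(n)\to\mathrm{Sp}(n)$ be the metaplectic group with its projection. That is, $\mathrm{Mp}(n)$ is the group of unitary operators generated by $$\widehat S_{W,m}\psi(x)=\left(\tfrac1{2\pi i\hbar}\right)^{n/2}i^m\sqrt{|\det L|}\int e^{\frac i\hbar W(x,x')}\psi(x')\,dx',\qquad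 W(x,x')=\tfrac12Px\cdot x-Lx\cdot x'+\tfrac12Qx'\cdot x',$$ where $P,Q$ are real symmetric, $\det L\ne0$ and $m\pi$ is an argument of $\det L$; and $\pi(\widehat S_{W,m})$ is the matrix $S_W$ with $(x,p)=S_W(x',p')\iff p=\partial_xW,\ p'=-\partial_{x'}W$. Let $t\mapsto\widehat S_t(z_0)$, $t\in I$, be the strongly continuous path in $\mathrm{Mp}(n)$ with $\widehat S_0(z_0)=\mathrm{Id}$ and $\pi(\widehat S_t(z_0))=S_t(z_0)$. The nearby-orbit propagator is $$U(t,z_0)\psi=e^{\frac i\hbar\gamma(z_0,t)}\,\widehat T(f_t(z_0))\,\widehat S_t(z_0)\,\widehat T(z_0)^{-1}\psi,\qquad \gamma(z_0,t)=\int_0^t\left(\tfrac12\sigma(z(s),\dot z(s))-H(z(s),s)\right)ds,\quad z(s)=f_s(z_0).$$ For $M$ in the Siegel half-space $\Sigma(n)=\{M\in\mathbb C^{n\times n}:M=M^T,\ \operatorname{Im}M>0\}$ let $$\phi^\hbar_M(x)=\left(\tfrac1{\pi\hbar}\right)^{n/4}(\det\operatorname{Im}M)^{1/4}e^{\frac i{2\hbar}Mx\cdot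 x},\qquad \phi^\hbar_{z_0,M}=\widehat T(z_0)\phi^\hbar_M ,$$ and put $\alpha(S_t)M=(C_t+D_tM)(A_t+B_tM)^{-1}$. Then for every $M\in\Sigma(n)$ and every $t\in I$ we have $\det(A_t+B_tM)\neq0$, $\alpha(S_t(z_0))M\in\Sigma(n)$, and $$U(t,z_0)\phi^\hbar_{z_0,M}=e^{\frac i\hbar\gamma(z_0,t)}\,\theta(t)\,\phi^\hbar_{f_t(z_0),\,\alpha(S_t(z_0))M},$$ where $\theta(t)$ is the metaplectic phase factor: the continuous function on $I$ with $\theta(0)=1$ and $$\theta(t)^2=\frac{|\det(A_t+B_tM)|}{\det(A_t+B_tM)}$$ (so $|\theta(t)|=1$). -/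

import Mathlib

open MeasureTheory Filter Topology

noncomputable section

namespace NearbyOrbit

/-- Configuration space `ℝⁿ` with its Euclidean structure. -/
abbrev Config (n : ℕ) : Type := EuclideanSpace ℝ (Fin n)

/-- Phase space `ℝ²ⁿ`, with points `z = (x, p)`. -/
abbrev Phase (n : ℕ) : Type := Config n × Config n

/-- The Hilbert space `L²(ℝⁿ)`. -/
abbrev L2 (n : ℕ) : Type := Lp ℂ 2 (volume : Measure (Config n))

/-- Real `2n × 2n` matrices, written in `n × n` blocks. -/
abbrev PhaseMatrix (n : ℕ) : Type := Matrix (Fin n ⊕ Fin n) (Fin n ⊕ Fin n) ℝ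

/-- The symplectic form `σ(z, z') = p · x' - p' · x`. -/
def sigma {n : ℕ} (z z' : Phase n) : ℝ := inner ℝ z.2 z'.1 - inner ℝ z'.2 z.1

/-! ### Heisenberg--Weyl operators -/

/-- The function `x ↦ exp ((i/ħ)(p₀·x - p₀·x₀/2)) ψ(x - x₀)`. -/
def hwFun {n : ℕ} (ħ : ℝ) (z₀ : Phase n) (ψ : Config n → ℂ) (x : Config n) : ℂ :=
  Complex.exp (Complex.I / ħ * ((inner ℝ z₀.2 x - 1 / 2 * inner ℝ z₀.2 z₀.1 : ℝ) : ℂ))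
    * ψ (x - z₀.1)

theorem norm_hwFun {n : ℕ} (ħ : ℝ) (z₀ : Phase n) (ψ : Config n → ℂ) (x : Config n) :
    ‖hwFun ħ z₀ ψ x‖ = ‖ψ (x - z₀.1)‖ := by
  have h : Complex.I / ħ * ((inner ℝ z₀.2 x - 1 / 2 * inner ℝ z₀.2 z₀.1 : ℝ) : ℂ)
      = (((inner ℝ z₀.2 x - 1 / 2 * inner ℝ z₀.2 z₀.1) / ħ : ℝ) : ℂ) * Complex.I := by
    push_cast; ring
  rw [hwFun, norm_mul, h, Complex.norm_exp_ofReal_mul_I, one_mul]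

theorem memLp_hwFun {n : ℕ} (ħ : ℝ) (z₀ : Phase n) {ψ : Config n → ℂ}
    (hψ : MemLp ψ 2 (volume : Measure (Config n))) :
    MemLp (hwFun ħ z₀ ψ) 2 (volume : Measure (Config n)) := by
  have hm : MemLp (fun x => ψ (x - z₀.1)) 2 (volume : Measure (Config n)) :=
    hψ.comp_measurePreserving (measurePreserving_sub_right volume z₀.1)
  refine hm.of_le ?_ (ae_of_all _ fun x => (norm_hwFun ħ z₀ ψ x).le)
  refine AEStronglyMeasurable.mul ?_ hm.aestronglyMeasurable
  exact Continuous.aestronglyMeasurable (by fun_prop)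

theorem hwFun_congr {n : ℕ} (ħ : ℝ) (z₀ : Phase n) {ψ φ : Config n → ℂ}
    (h : ψ =ᵐ[volume] φ) : hwFun ħ z₀ ψ =ᵐ[volume] hwFun ħ z₀ φ := by
  have h' := (measurePreserving_sub_right (volume : Measure (Config n)) z₀.1).quasiMeasurePreserving.ae_eq h
  filter_upwards [h'] with x hx
  simp only [Function.comp] at hx
  simp only [hwFun, hx]

theorem hwFun_neg {n : ℕ} (ħ : ℝ) (z₀ : Phase n) (ψ : Config n → ℂ) :
    hwFun ħ z₀ (hwFun ħ (-z₀) ψ) = ψ := by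
  funext x
  simp only [hwFun, ← mul_assoc, ← Complex.exp_add]
  have : Complex.I / ħ * ((inner ℝ z₀.2 x - 1 / 2 * inner ℝ z₀.2 z₀.1 : ℝ) : ℂ)
      + Complex.I / ħ * ((inner ℝ (-z₀).2 (x - z₀.1)
        - 1 / 2 * inner ℝ (-z₀).2 (-z₀).1 : ℝ) : ℂ) = 0 := by
    simp only [Prod.snd_neg, Prod.fst_neg, inner_neg_left, inner_neg_right, inner_sub_right]
    push_cast; ring
  rw [this]
  simp

/-- The map `hwFun` on classes of square-integrable functions. -/
def hwMap {n : ℕ} (ħ : ℝ) (z₀ : Phase n) (ψ : L2 n) : L2 n :=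
  (memLp_hwFun ħ z₀ (Lp.memLp ψ)).toLp (hwFun ħ z₀ ψ)

theorem hwMap_hwMap_neg {n : ℕ} (ħ : ℝ) (z₀ : Phase n) (ψ : L2 n) :
    hwMap ħ z₀ (hwMap ħ (-z₀) ψ) = ψ := by
  apply Lp.ext
  refine (MemLp.coeFn_toLp _).trans ?_
  refine (hwFun_congr ħ z₀ (MemLp.coeFn_toLp (memLp_hwFun ħ (-z₀) (Lp.memLp ψ)))).trans ?_
  rw [hwFun_neg]

/-- The Heisenberg--Weyl operator `T̂(z₀)`, a unitary operator on `L²(ℝⁿ)`. -/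
def heisenbergWeyl {n : ℕ} (ħ : ℝ) (z₀ : Phase n) : L2 n ≃ₗᵢ[ℂ] L2 n where
  toFun := hwMap ħ z₀
  invFun := hwMap ħ (-z₀)
  left_inv ψ := by simpa using hwMap_hwMap_neg ħ (-z₀) ψ
  right_inv ψ := hwMap_hwMap_neg ħ z₀ ψ
  map_add' ψ φ := by
    apply Lp.ext
    refine (MemLp.coeFn_toLp _).trans ?_
    refine (hwFun_congr ħ z₀ (Lp.coeFn_add ψ φ)).trans ?_
    refine EventuallyEq.trans ?_ (Lp.coeFn_add _ _).symm
    filter_upwards [MemLp.coeFn_toLp (memLp_hwFun ħ z₀ (Lp.memLp ψ)),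
      MemLp.coeFn_toLp (memLp_hwFun ħ z₀ (Lp.memLp φ))] with x h1 h2
    simp only [hwMap, Pi.add_apply, h1, h2]
    simp only [hwFun, Pi.add_apply, mul_add]
  map_smul' c ψ := by
    apply Lp.ext
    refine (MemLp.coeFn_toLp _).trans ?_
    refine (hwFun_congr ħ z₀ (Lp.coeFn_smul c ψ)).trans ?_
    refine EventuallyEq.trans ?_ (Lp.coeFn_smul _ _).symm
    filter_upwards [MemLp.coeFn_toLp (memLp_hwFun ħ z₀ (Lp.memLp ψ))] with x h1
    simp only [hwMap, Pi.smul_apply, h1, RingHom.id_apply]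
    simp only [hwFun, Pi.smul_apply, smul_eq_mul]
    ring
  norm_map' ψ := by
    change ‖hwMap ħ z₀ ψ‖ = ‖ψ‖
    have h : eLpNorm (hwFun ħ z₀ ψ) 2 (volume : Measure (Config n)) = eLpNorm ψ 2 volume := by
      rw [← eLpNorm_comp_measurePreserving (Lp.aestronglyMeasurable ψ)
        (measurePreserving_sub_right volume z₀.1)]
      exact eLpNorm_congr_norm_ae (ae_of_all _ fun x => norm_hwFun ħ z₀ ψ x)
    rw [hwMap, Lp.norm_toLp, h, Lp.norm_def]

/-! ### Squeezed coherent states -/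

/-- The Siegel half-space `Σ(n)`. -/
def siegel (n : ℕ) : Set (Matrix (Fin n) (Fin n) ℂ) :=
  {M | M.transpose = M ∧ (M.map Complex.im).PosDef}

/-- The complex quadratic form `M x² = x · M x` at a real vector `x`. -/
def quad {n : ℕ} (M : Matrix (Fin n) (Fin n) ℂ) (x : Config n) : ℂ :=
  (fun i => (x i : ℂ)) ⬝ᵥ (M.mulVec fun i => (x i : ℂ))

/-- The Gaussian `φ_M(x) = (1/(πħ))^(n/4) (det Im M)^(1/4) exp ((i/(2ħ)) M x²)`. -/
def gaussFun {n : ℕ} (ħ : ℝ) (M : Matrix (Fin n) (Fin n) ℂ) (x : Config n) : ℂ :=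
  (((1 / (Real.pi * ħ)) ^ ((n : ℝ) / 4) * (M.map Complex.im).det ^ (1 / 4 : ℝ) : ℝ) : ℂ)
    * Complex.exp (Complex.I / (2 * ħ) * quad M x)

theorem quad_im {n : ℕ} (M : Matrix (Fin n) (Fin n) ℂ) (x : Config n) :
    (quad M x).im = x.ofLp ⬝ᵥ ((M.map Complex.im).mulVec x.ofLp) := by
  simp [quad, dotProduct, Matrix.mulVec, Complex.mul_im, Complex.mul_re]

theorem exists_pos_le_quad {n : ℕ} {M : Matrix (Fin n) (Fin n) ℂ} (hM : M ∈ siegel n) :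
    ∃ c : ℝ, 0 < c ∧ ∀ x : Config n, c * ‖x‖ ^ 2 ≤ (quad M x).im := by
  have hcont : Continuous fun x : Config n => (quad M x).im := by
    simp only [quad_im, dotProduct, Matrix.mulVec]
    fun_prop
  have hpos : ∀ x : Config n, x ≠ 0 → 0 < (quad M x).im := by
    intro x hx
    rw [quad_im]
    have h := hM.2.dotProduct_mulVec_pos (x := x.ofLp) (by simpa using hx)
    simpa using h
  rcases (Metric.sphere (0 : Config n) 1).eq_empty_or_nonempty with he | hne
  · refine ⟨1, one_pos, fun x => ?_⟩
    have hx : x = 0 := by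
      by_contra hx
      have : (‖x‖⁻¹ • x) ∈ Metric.sphere (0 : Config n) 1 := by
        simp [norm_smul, hx]
      rw [he] at this
      exact this
    subst hx
    simp [quad]
  · obtain ⟨y, hy, hmin⟩ := (isCompact_sphere (0 : Config n) 1).exists_isMinOn hne
      hcont.continuousOn
    have hy0 : y ≠ 0 := by
      rintro rfl
      simp at hy
    refine ⟨(quad M y).im, hpos y hy0, fun x => ?_⟩
    by_cases hx : x = 0
    · subst hx
      simp [quad]
    have hs : (‖x‖⁻¹ • x) ∈ Metric.sphere (0 : Config n) 1 := by
      simp [norm_smul, hx]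
    have h1 : (quad M y).im ≤ (quad M (‖x‖⁻¹ • x)).im := hmin hs
    have h2 : (quad M (‖x‖⁻¹ • x)).im = ‖x‖⁻¹ ^ 2 * (quad M x).im := by
      rw [quad_im, quad_im]
      simp only [WithLp.ofLp_smul, Matrix.mulVec_smul, smul_dotProduct, dotProduct_smul,
        smul_eq_mul]
      ring
    have hnx : 0 < ‖x‖ := norm_pos_iff.mpr hx
    rw [h2] at h1
    calc (quad M y).im * ‖x‖ ^ 2 ≤ ‖x‖⁻¹ ^ 2 * (quad M x).im * ‖x‖ ^ 2 := by gcongr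
      _ = (quad M x).im := by field_simp

theorem memLp_gaussFun {n : ℕ} {ħ : ℝ} (hħ : 0 < ħ) {M : Matrix (Fin n) (Fin n) ℂ}
    (hM : M ∈ siegel n) : MemLp (gaussFun ħ M) 2 (volume : Measure (Config n)) := by
  obtain ⟨c, hc, hq⟩ := exists_pos_le_quad hM
  have hcont : Continuous (gaussFun ħ M) := by
    unfold gaussFun quad
    simp only [dotProduct, Matrix.mulVec]
    fun_prop
  rw [memLp_two_iff_integrable_sq_norm hcont.aestronglyMeasurable]
  set K : ℝ := (1 / (Real.pi * ħ)) ^ ((n : ℝ) / 4) * (M.map Complex.im).det ^ (1 / 4 : ℝ) with hK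
  have hint : Integrable (fun x : Config n => K ^ 2 * Real.exp (-(c / ħ) * ‖x‖ ^ 2)) := by
    have h := (GaussianFourier.integrable_cexp_neg_mul_sq_norm_add (V := Config n)
      (b := ((c / ħ : ℝ) : ℂ)) (by simpa using div_pos hc hħ) 0 0).norm
    refine Integrable.const_mul (h.congr (ae_of_all _ fun x => ?_)) _
    simp only [Complex.norm_exp]
    congr 1
    simp [← Complex.ofReal_pow, ← Complex.ofReal_neg]
  refine hint.mono' (hcont.norm.pow 2).aestronglyMeasurable (ae_of_all _ fun x => ?_)
  have hre : (Complex.I / (2 * ħ) * quad M x).re = -((quad M x).im / (2 * ħ)) := by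
    have : Complex.I / (2 * ħ) * quad M x = ((1 / (2 * ħ) : ℝ) : ℂ) * (Complex.I * quad M x) := by
      push_cast; ring
    rw [this, Complex.re_ofReal_mul]
    simp
    ring
  rw [Real.norm_of_nonneg (by positivity), gaussFun, norm_mul, Complex.norm_exp, hre, mul_pow,
    ← Real.exp_nat_mul, Complex.norm_real, Real.norm_eq_abs, sq_abs]
  refine mul_le_mul_of_nonneg_left (Real.exp_le_exp.mpr ?_) (sq_nonneg _)
  have : c * ‖x‖ ^ 2 / ħ ≤ (quad M x).im / ħ := div_le_div_of_nonneg_right (hq x) hħ.le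
  calc ((2 : ℕ) : ℝ) * -((quad M x).im / (2 * ħ)) = -((quad M x).im / ħ) := by
        push_cast; field_simp
    _ ≤ -(c * ‖x‖ ^ 2 / ħ) := neg_le_neg this
    _ = -(c / ħ) * ‖x‖ ^ 2 := by ring

/-- The squeezed coherent state `φ_{z₀,M} = T̂(z₀) φ_M`, an element of `L²(ℝⁿ)`. -/
def squeezedState {n : ℕ} {ħ : ℝ} (hħ : 0 < ħ) (z₀ : Phase n)
    {M : Matrix (Fin n) (Fin n) ℂ} (hM : M ∈ siegel n) : L2 n :=
  heisenbergWeyl ħ z₀ ((memLp_gaussFun hħ hM).toLp (gaussFun ħ M))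

/-- `A + B M`, for `S = (A B; C D)`. -/
def siegelDenom {n : ℕ} (S : PhaseMatrix n) (M : Matrix (Fin n) (Fin n) ℂ) :
    Matrix (Fin n) (Fin n) ℂ :=
  S.toBlocks₁₁.map Complex.ofReal + S.toBlocks₁₂.map Complex.ofReal * M

/-- `α(S) M = (C + D M)(A + B M)⁻¹`, for `S = (A B; C D)`. -/
def siegelAction {n : ℕ} (S : PhaseMatrix n) (M : Matrix (Fin n) (Fin n) ℂ) :
    Matrix (Fin n) (Fin n) ℂ :=
  (S.toBlocks₂₁.map Complex.ofReal + S.toBlocks₂₂.map Complex.ofReal * M) * (siegelDenom S M)⁻¹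

/-! ### The metaplectic group -/

/-- The quadratic form `W(x, x') = P x·x / 2 - L x·x' + Q x'·x' / 2`. -/
def genForm {n : ℕ} (P L Q : Matrix (Fin n) (Fin n) ℝ) (x x' : Config n) : ℝ :=
  1 / 2 * (P.mulVec x.ofLp ⬝ᵥ x.ofLp) - L.mulVec x.ofLp ⬝ᵥ x'.ofLp
    + 1 / 2 * (Q.mulVec x'.ofLp ⬝ᵥ x'.ofLp)

/-- The free symplectic matrix generated by `W`; see `freeSymplectic_spec`. -/
def freeSymplectic {n : ℕ} (P L Q : Matrix (Fin n) (Fin n) ℝ) : PhaseMatrix n :=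
  Matrix.fromBlocks (L⁻¹ * Q) L⁻¹ (P * L⁻¹ * Q - L.transpose) (P * L⁻¹)

/-- `(x, p) = S_W (x', p')` if and only if `p = ∂_x W(x, x')` and `p' = - ∂_{x'} W(x, x')`. -/
theorem freeSymplectic_spec {n : ℕ} (P L Q : Matrix (Fin n) (Fin n) ℝ) (hL : L.det ≠ 0)
    (x p x' p' : Fin n → ℝ) :
    Sum.elim x p = (freeSymplectic P L Q).mulVec (Sum.elim x' p') ↔
      p = P.mulVec x - L.transpose.mulVec x' ∧ p' = L.mulVec x - Q.mulVec x' := by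
  have hu : IsUnit L.det := isUnit_iff_ne_zero.mpr hL
  have key : x = L⁻¹.mulVec (Q.mulVec x') + L⁻¹.mulVec p' ↔ p' = L.mulVec x - Q.mulVec x' := by
    rw [← Matrix.mulVec_add]
    constructor
    · intro h
      rw [h, Matrix.mulVec_mulVec, Matrix.mul_nonsing_inv _ hu, Matrix.one_mulVec]
      abel
    · intro h
      rw [h, add_sub_cancel, Matrix.mulVec_mulVec, Matrix.nonsing_inv_mul _ hu,
        Matrix.one_mulVec]
  rw [freeSymplectic, Matrix.fromBlocks_mulVec, Sum.elim_eq_iff]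
  simp only [Sum.elim_comp_inl, Sum.elim_comp_inr, Matrix.sub_mulVec, ← Matrix.mulVec_mulVec]
  rw [key, and_comm]
  refine and_congr_left fun h => ?_
  rw [← key] at h
  have : P.mulVec x = P.mulVec (L⁻¹.mulVec (Q.mulVec x')) + P.mulVec (L⁻¹.mulVec p') := by
    rw [← Matrix.mulVec_add, ← h]
  rw [this]
  constructor <;> (intro h2; rw [h2]; abel)

/-- The generalized Fourier transform
`ψ ↦ (1/(2πiħ))^(n/2) i^m |det L|^(1/2) ∫ exp ((i/ħ) W(x, x')) ψ(x') dx'`. -/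
def genFourier {n : ℕ} (ħ : ℝ) (P L Q : Matrix (Fin n) (Fin n) ℝ) (m : ℤ)
    (ψ : Config n → ℂ) (x : Config n) : ℂ :=
  (1 / (2 * (Real.pi : ℂ) * Complex.I * (ħ : ℂ))) ^ ((n : ℂ) / 2) * Complex.I ^ m
    * ((√|L.det| : ℝ) : ℂ)
    * ∫ x' : Config n, Complex.exp (Complex.I / ħ * (genForm P L Q x x' : ℂ)) * ψ x'

/-- The pairs `(Ŝ_{W,m}, S_W)`. The unitary operator `Ŝ_{W,m}` is pinned down by its integral
formula on the dense space `L¹ ∩ L²`; the condition on `m` says that `m π` is an argument of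
`det L`. -/
def metaplecticGenerators (n : ℕ) (ħ : ℝ) :
    Set ((L2 n ≃ₗᵢ[ℂ] L2 n) × Matrix.symplecticGroup (Fin n) ℝ) :=
  {g | ∃ (P L Q : Matrix (Fin n) (Fin n) ℝ) (m : ℤ),
    P.transpose = P ∧ Q.transpose = Q ∧ 0 < (-1 : ℝ) ^ m * L.det ∧
    (g.2 : PhaseMatrix n) = freeSymplectic P L Q ∧
    ∀ ψ : L2 n, Integrable ψ (volume : Measure (Config n)) →
      (g.1 ψ : Config n → ℂ) =ᵐ[volume] genFourier ħ P L Q m ψ}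

/-- The graph `{(Ŝ, π(Ŝ))}` of the projection `π : Mp(n) → Sp(n)`. The group `Mp(n)` is generated by
the operators `Ŝ_{W,m}` and `π` is the homomorphism with `π(Ŝ_{W,m}) = S_W`, so its graph is the
subgroup of `U(L²(ℝⁿ)) × Sp(n)` generated by the pairs `(Ŝ_{W,m}, S_W)`. -/
def metaplecticGraph (n : ℕ) (ħ : ℝ) :
    Subgroup ((L2 n ≃ₗᵢ[ℂ] L2 n) × Matrix.symplecticGroup (Fin n) ℝ) :=
  Subgroup.closure (metaplecticGenerators n ħ)

/-- `Ŝ ∈ Mp(n)` and `π(Ŝ) = S`. -/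
def HasProjection {n : ℕ} (ħ : ℝ) (Shat : L2 n ≃ₗᵢ[ℂ] L2 n) (S : PhaseMatrix n) : Prop :=
  ∃ g ∈ metaplecticGraph n ħ, g.1 = Shat ∧ (g.2 : PhaseMatrix n) = S

/-- On the interval `I`, `t ↦ Ŝ_t` is the path in `Mp(n)`, continuous for the strong operator
topology, that lifts `t ↦ S_t` and passes through the identity at time `0`. -/
structure IsMetaplecticLift {n : ℕ} (ħ : ℝ) (I : Set ℝ) (S : ℝ → PhaseMatrix n)
    (Shat : ℝ → (L2 n ≃ₗᵢ[ℂ] L2 n)) : Prop where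
  map_zero : Shat 0 = 1
  continuousOn : ∀ ψ : L2 n, ContinuousOn (fun t => Shat t ψ) I
  projection : ∀ t ∈ I, HasProjection ħ (Shat t) (S t)

/-! ### Hamiltonian flow and the nearby-orbit propagator -/

/-- The Hamiltonian vector field `J ∂_z H = (∂_p H, -∂_x H)`. -/
def hamiltonianField {n : ℕ} (H : Phase n → ℝ → ℝ) (t : ℝ) (z : Phase n) : Phase n :=
  (gradient (fun p => H (z.1, p) t) z.2, -gradient (fun x => H (x, z.2) t) z.1)

/-- `f` is the flow of Hamilton's equations near the orbit of `z₀` on the time interval `I`: for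
every `t ∈ I` and all `z` close to `z₀`, the curve `s ↦ f_s(z)` is the solution between the times
`0` and `t` that starts at `z`. -/
def IsHamiltonianFlowNear {n : ℕ} (H : Phase n → ℝ → ℝ) (I : Set ℝ) (z₀ : Phase n)
    (f : ℝ → Phase n → Phase n) : Prop :=
  ∀ t ∈ I, ∀ᶠ z in 𝓝 z₀, f 0 z = z ∧ ∀ s ∈ Set.uIcc 0 t,
    HasDerivWithinAt (fun τ => f τ z) (hamiltonianField H s (f s z)) (Set.uIcc 0 t) s

/-- The Jacobian matrix `S_t(z₀) = D f_t(z₀)`. -/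
def flowJacobian {n : ℕ} (f : ℝ → Phase n → Phase n) (z₀ : Phase n) (t : ℝ) : PhaseMatrix n :=
  Matrix.fromBlocks
    (Matrix.of fun i j => (fderiv ℝ (f t) z₀ (EuclideanSpace.single j 1, 0)).1 i)
    (Matrix.of fun i j => (fderiv ℝ (f t) z₀ (0, EuclideanSpace.single j 1)).1 i)
    (Matrix.of fun i j => (fderiv ℝ (f t) z₀ (EuclideanSpace.single j 1, 0)).2 i)
    (Matrix.of fun i j => (fderiv ℝ (f t) z₀ (0, EuclideanSpace.single j 1)).2 i)

/-- The phase `γ(z₀, t) = ∫₀ᵗ (σ(z, ż) / 2 - H(z, s)) ds` along the orbit `z(s) = f_s(z₀)`. -/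
def gammaPhase {n : ℕ} (H : Phase n → ℝ → ℝ) (f : ℝ → Phase n → Phase n) (z₀ : Phase n)
    (t : ℝ) : ℝ :=
  ∫ s in (0 : ℝ)..t, (1 / 2 * sigma (f s z₀) (deriv (fun τ => f τ z₀) s) - H (f s z₀) s)

/-- The nearby-orbit propagator
`U(t, z₀) ψ = exp ((i/ħ) γ(z₀, t)) T̂(f_t(z₀)) Ŝ_t(z₀) T̂(z₀)⁻¹ ψ`, where `Shat t` is `Ŝ_t(z₀)`. -/
def nearbyOrbitPropagator {n : ℕ} (ħ : ℝ) (H : Phase n → ℝ → ℝ) (f : ℝ → Phase n → Phase n)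
    (Shat : ℝ → (L2 n ≃ₗᵢ[ℂ] L2 n)) (t : ℝ) (z₀ : Phase n) (ψ : L2 n) : L2 n :=
  Complex.exp (Complex.I / ħ * (gammaPhase H f z₀ t : ℂ)) •
    heisenbergWeyl ħ (f t z₀) (Shat t ((heisenbergWeyl ħ z₀)⁻¹ ψ))

end NearbyOrbit

end

open NearbyOrbit

/-! The Heisenberg–Weyl operators only move the centre, so the claim reduces to `Ŝ_t φ_M = θ(t)
φ_{α(S_t)M}` with a continuous phase.

Algebra: the frame `(A + BM, C + DM)` is the image under `S` of the graph of `M`. Since `S`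
preserves the symplectic form, the frame stays Lagrangian and its Hermitian form stays `2i Im M`
(`siegel_frame`). Invertibility of `A + BM`, symmetry and positivity of `α(S)M`, and the change of
`det Im M` all follow.

Operators: a generator sends `φ_M` to a Gaussian integral, which a real congruence splits into
one-dimensional ones. The result is `c φ_{α(S)M}` with `c² = |det(A + BM)| / det(A + BM)`
(`exists_genFourier_gaussFun`). Only `c²` is tracked, so no sign of a root matters; as `A + BM` is a
cocycle, the property passes to products and inverses, hence to all of `Mp(n)`.

Continuity: `φ_{α(S)M}` is nonzero, so the operator itself determines `c` and no branch of a square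
root is chosen. Strong continuity of `Ŝ_t` makes the phase continuous, because `L²` convergence of
unit multiples of Gaussians forces convergence of the multipliers
(`tendsto_phase_of_tendsto_smul_gaussState`). -/

namespace NearbyOrbit
open Matrix
open scoped ComplexOrder MatrixOrder

/-! ### Complexification of real matrices and positive definiteness -/

section MapOfReal

variable {m n : Type*} [Fintype n]

theorem map_ofReal_mul (A : Matrix m n ℝ) (B : Matrix n m ℝ) :
    (A * B).map Complex.ofReal = A.map Complex.ofReal * B.map Complex.ofReal :=
  Matrix.map_mul (f := Complex.ofRealHom)

theorem map_ofReal_add {m n : Type*} (A B : Matrix m n ℝ) :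
    (A + B).map Complex.ofReal = A.map Complex.ofReal + B.map Complex.ofReal :=
  Matrix.map_add _ Complex.ofReal_add A B

theorem map_ofReal_conjTranspose {m n : Type*} (A : Matrix m n ℝ) :
    (A.map Complex.ofReal)ᴴ = Aᵀ.map Complex.ofReal := by
  ext i j; simp

theorem map_ofReal_one {n : Type*} [DecidableEq n] :
    (1 : Matrix n n ℝ).map Complex.ofReal = 1 :=
  Matrix.map_one _ Complex.ofReal_zero Complex.ofReal_one

theorem det_map_ofReal [DecidableEq n] (A : Matrix n n ℝ) :
    (A.map Complex.ofReal).det = (A.det : ℂ) :=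
  (Complex.ofRealHom.map_det A).symm

/-- A real positive definite matrix is `Cᵀ C` with `C` invertible. -/
theorem exists_transpose_mul_self [DecidableEq n] {Y : Matrix n n ℝ} (hY : Y.PosDef) :
    ∃ C : Matrix n n ℝ, IsUnit C.det ∧ Y = Cᵀ * C := by
  obtain ⟨C, hC⟩ := CStarAlgebra.nonneg_iff_eq_star_mul_self.1 hY.posSemidef.nonneg
  rw [star_eq_conjTranspose, conjTranspose_eq_transpose_of_trivial] at hC
  refine ⟨C, ?_, hC⟩
  have h := hY.det_pos
  rw [hC, det_mul, det_transpose] at h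
  exact isUnit_iff_ne_zero.2 fun h0 => by simp [h0] at h

theorem posDef_map_ofReal {Y : Matrix n n ℝ} (hY : Y.PosDef) :
    (Y.map Complex.ofReal).PosDef := by
  classical
  obtain ⟨C, hC, rfl⟩ := exists_transpose_mul_self hY
  rw [map_ofReal_mul, ← map_ofReal_conjTranspose]
  refine PosDef.conjTranspose_mul_self _ ?_
  refine mulVec_injective_of_isUnit ((isUnit_iff_isUnit_det _).2 ?_)
  rw [det_map_ofReal]
  exact hC.map Complex.ofRealHom

theorem ofReal_dotProduct_mulVec (Y : Matrix n n ℝ) (x : n → ℝ) :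
    star (fun i => (x i : ℂ)) ⬝ᵥ (Y.map Complex.ofReal).mulVec (fun i => (x i : ℂ))
      = ((x ⬝ᵥ Y.mulVec x : ℝ) : ℂ) := by
  simp [dotProduct, mulVec]

theorem posDef_of_map_ofReal {Y : Matrix n n ℝ} (hY : (Y.map Complex.ofReal).PosDef) :
    Y.PosDef := by
  refine PosDef.of_dotProduct_mulVec_pos ?_ fun x hx => ?_
  · ext i j
    have h := congrFun (congrFun hY.1 i) j
    simpa using h
  · have h := hY.dotProduct_mulVec_pos (x := fun i => (x i : ℂ)) ?_
    · rw [ofReal_dotProduct_mulVec] at h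
      simpa using h
    · intro h0
      exact hx (funext fun i => by simpa using congrFun h0 i)

theorem sub_conjTranspose_of_symm {n : Type*} {M : Matrix n n ℂ} (hM : Mᵀ = M) :
    M - Mᴴ = (2 * Complex.I) • (M.map Complex.im).map Complex.ofReal := by
  ext i j
  have h : M j i = M i j := congrFun (congrFun hM i) j
  simp only [Matrix.sub_apply, conjTranspose_apply, h, Matrix.smul_apply, map_apply, smul_eq_mul]
  apply Complex.ext <;> simp
  ring

end MapOfReal

/-! ### The symplectic action on the Siegel half-space -/

variable {n : ℕ}

/-- `C + D M`, for `S = (A B; C D)`. -/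
noncomputable def siegelNum (S : PhaseMatrix n) (M : Matrix (Fin n) (Fin n) ℂ) :
    Matrix (Fin n) (Fin n) ℂ :=
  S.toBlocks₂₁.map Complex.ofReal + S.toBlocks₂₂.map Complex.ofReal * M

theorem siegelAction_eq (S : PhaseMatrix n) (M : Matrix (Fin n) (Fin n) ℂ) :
    siegelAction S M = siegelNum S M * (siegelDenom S M)⁻¹ := rfl

/-- These are the block entries of `Sᵀ J S = J`. -/
theorem symplectic_blocks {S : PhaseMatrix n} (hS : S ∈ symplecticGroup (Fin n) ℝ) :
    S.toBlocks₁₁ᵀ * S.toBlocks₂₁ = S.toBlocks₂₁ᵀ * S.toBlocks₁₁ ∧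
    S.toBlocks₁₂ᵀ * S.toBlocks₂₂ = S.toBlocks₂₂ᵀ * S.toBlocks₁₂ ∧
    S.toBlocks₁₁ᵀ * S.toBlocks₂₂ - S.toBlocks₂₁ᵀ * S.toBlocks₁₂ = 1 := by
  rw [SymplecticGroup.mem_iff', ← fromBlocks_toBlocks S, J, fromBlocks_transpose,
    fromBlocks_multiply, fromBlocks_multiply, fromBlocks_inj] at hS
  simp only [Matrix.mul_zero, Matrix.mul_one, Matrix.mul_neg, _root_.zero_add, _root_.add_zero,
    Matrix.neg_mul] at hS
  obtain ⟨h1, h2, -, h4⟩ := hS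
  refine ⟨?_, ?_, ?_⟩
  · rw [add_neg_eq_zero] at h1; exact h1.symm
  · rw [add_neg_eq_zero] at h4; exact h4.symm
  · rw [← neg_inj, ← h2]; abel

/-- Lagrangian identities for the frame `(A + B M, C + D M)`. -/
theorem siegel_frame {S : PhaseMatrix n} (hS : S ∈ symplecticGroup (Fin n) ℝ)
    (M N : Matrix (Fin n) (Fin n) ℂ) :
    (S.toBlocks₁₁ᵀ.map Complex.ofReal + N * S.toBlocks₁₂ᵀ.map Complex.ofReal) * siegelNum S M
      - (S.toBlocks₂₁ᵀ.map Complex.ofReal + N * S.toBlocks₂₂ᵀ.map Complex.ofReal)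
        * siegelDenom S M = M - N := by
  obtain ⟨h1, h2, h3⟩ := symplectic_blocks hS
  have h4 : S.toBlocks₂₂ᵀ * S.toBlocks₁₁ - S.toBlocks₁₂ᵀ * S.toBlocks₂₁ = 1 := by
    have := congrArg transpose h3
    simpa [transpose_mul] using this
  replace h1 := congrArg (fun A : Matrix _ _ ℝ => A.map Complex.ofReal) h1
  replace h2 := congrArg (fun A : Matrix _ _ ℝ => A.map Complex.ofReal) h2
  replace h3 := congrArg (fun A : Matrix _ _ ℝ => A.map Complex.ofReal) (sub_eq_iff_eq_add.1 h3)
  replace h4 := congrArg (fun A : Matrix _ _ ℝ => A.map Complex.ofReal) (sub_eq_iff_eq_add.1 h4)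
  simp only [map_ofReal_mul, map_ofReal_add, map_ofReal_one] at h1 h2 h3 h4
  simp only [siegelNum, siegelDenom]
  -- By the block relations the first two brackets vanish, the third is `1` and the fourth is `-1`.
  have e : ∀ A A' B B' C C' D D' : Matrix (Fin n) (Fin n) ℂ,
      (A' + N * B') * (C + D * M) - (C' + N * D') * (A + B * M)
        = (A' * C - C' * A) + N * (B' * D - D' * B) * M + (A' * D - C' * B) * M
          + N * (B' * C - D' * A) := by
    intros; noncomm_ring
  rw [e, h1, h2, h3, h4]
  noncomm_ring

theorem siegelDenom_transpose (S : PhaseMatrix n) {M : Matrix (Fin n) (Fin n) ℂ} (hM : Mᵀ = M) :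
    (siegelDenom S M)ᵀ
      = S.toBlocks₁₁ᵀ.map Complex.ofReal + M * S.toBlocks₁₂ᵀ.map Complex.ofReal := by
  simp [siegelDenom, transpose_mul, hM, transpose_map]

theorem siegelNum_transpose (S : PhaseMatrix n) {M : Matrix (Fin n) (Fin n) ℂ} (hM : Mᵀ = M) :
    (siegelNum S M)ᵀ
      = S.toBlocks₂₁ᵀ.map Complex.ofReal + M * S.toBlocks₂₂ᵀ.map Complex.ofReal := by
  simp [siegelNum, transpose_mul, hM, transpose_map]

theorem siegelDenom_conjTranspose (S : PhaseMatrix n) (M : Matrix (Fin n) (Fin n) ℂ) :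
    (siegelDenom S M)ᴴ
      = S.toBlocks₁₁ᵀ.map Complex.ofReal + Mᴴ * S.toBlocks₁₂ᵀ.map Complex.ofReal := by
  simp [siegelDenom, map_ofReal_conjTranspose]

theorem siegelNum_conjTranspose (S : PhaseMatrix n) (M : Matrix (Fin n) (Fin n) ℂ) :
    (siegelNum S M)ᴴ
      = S.toBlocks₂₁ᵀ.map Complex.ofReal + Mᴴ * S.toBlocks₂₂ᵀ.map Complex.ofReal := by
  simp [siegelNum, map_ofReal_conjTranspose]

theorem siegel_frame_symm {S : PhaseMatrix n} (hS : S ∈ symplecticGroup (Fin n) ℝ)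
    {M : Matrix (Fin n) (Fin n) ℂ} (hM : Mᵀ = M) :
    (siegelDenom S M)ᵀ * siegelNum S M = (siegelNum S M)ᵀ * siegelDenom S M := by
  rw [← sub_eq_zero, siegelDenom_transpose S hM, siegelNum_transpose S hM, siegel_frame hS,
    sub_self]

/-- The case `N = Mᴴ` of `siegel_frame`; the case `N = M` is `siegel_frame_symm`. -/
theorem siegel_frame_im {S : PhaseMatrix n} (hS : S ∈ symplecticGroup (Fin n) ℝ)
    {M : Matrix (Fin n) (Fin n) ℂ} (hM : Mᵀ = M) :
    (siegelDenom S M)ᴴ * siegelNum S M - (siegelNum S M)ᴴ * siegelDenom S M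
      = (2 * Complex.I) • (M.map Complex.im).map Complex.ofReal := by
  rw [siegelDenom_conjTranspose, siegelNum_conjTranspose, siegel_frame hS,
    sub_conjTranspose_of_symm hM]

/-- Pairing `siegel_frame_im` with a kernel vector `v` of `A + BM` gives `v* (Im M) v = 0`, against
positivity. -/
theorem siegelDenom_det_ne_zero {S : PhaseMatrix n} (hS : S ∈ symplecticGroup (Fin n) ℝ)
    {M : Matrix (Fin n) (Fin n) ℂ} (hM : M ∈ siegel n) : (siegelDenom S M).det ≠ 0 := by
  intro h0
  obtain ⟨v, hv, hv0⟩ := exists_mulVec_eq_zero_iff.2 h0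
  have h1 := (posDef_map_ofReal hM.2).dotProduct_mulVec_pos hv
  have h2 := congrArg (fun A => star v ⬝ᵥ A.mulVec v) (siegel_frame_im hS hM.1)
  simp only [sub_mulVec, ← mulVec_mulVec, hv0, mulVec_zero, sub_zero, smul_mulVec,
    dotProduct_smul] at h2
  rw [dotProduct_mulVec, ← star_mulVec, hv0, star_zero, zero_dotProduct, eq_comm] at h2
  simp only [smul_eq_mul, mul_eq_zero, OfNat.ofNat_ne_zero, Complex.I_ne_zero, or_self,
    false_or] at h2
  exact h1.ne' h2

theorem siegelAction_transpose {S : PhaseMatrix n} (hS : S ∈ symplecticGroup (Fin n) ℝ)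
    {M : Matrix (Fin n) (Fin n) ℂ} (hM : M ∈ siegel n) :
    (siegelAction S M)ᵀ = siegelAction S M := by
  have hu : IsUnit (siegelDenom S M).det := isUnit_iff_ne_zero.2 (siegelDenom_det_ne_zero hS hM)
  have hu' : IsUnit (siegelDenom S M)ᵀ.det := by rwa [det_transpose]
  have h := siegel_frame_symm hS hM.1
  rw [siegelAction_eq, transpose_mul, transpose_nonsing_inv]
  calc ((siegelDenom S M)ᵀ)⁻¹ * (siegelNum S M)ᵀ
      = ((siegelDenom S M)ᵀ)⁻¹ * ((siegelNum S M)ᵀ * siegelDenom S M) * (siegelDenom S M)⁻¹ := by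
        rw [Matrix.mul_assoc, Matrix.mul_assoc, mul_nonsing_inv _ hu, Matrix.mul_one]
    _ = siegelNum S M * (siegelDenom S M)⁻¹ := by
        rw [← h, ← Matrix.mul_assoc, nonsing_inv_mul _ hu', Matrix.one_mul]

theorem siegelNum_eq_action_mul {S : PhaseMatrix n} (hS : S ∈ symplecticGroup (Fin n) ℝ)
    {M : Matrix (Fin n) (Fin n) ℂ} (hM : M ∈ siegel n) :
    siegelNum S M = siegelAction S M * siegelDenom S M := by
  rw [siegelAction_eq, Matrix.mul_assoc, nonsing_inv_mul _
    (isUnit_iff_ne_zero.2 (siegelDenom_det_ne_zero hS hM)), Matrix.mul_one]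

/-- Substituting `C + DM = α(S)M (A + BM)` into `siegel_frame_im` turns its left side into a
congruence of `2i Im α(S)M`. This yields both the positivity of `Im α(S)M` and its determinant. -/
theorem siegelDenom_conj_im_action {S : PhaseMatrix n} (hS : S ∈ symplecticGroup (Fin n) ℝ)
    {M : Matrix (Fin n) (Fin n) ℂ} (hM : M ∈ siegel n) :
    (siegelDenom S M)ᴴ * ((siegelAction S M).map Complex.im).map Complex.ofReal * siegelDenom S M
      = (M.map Complex.im).map Complex.ofReal := by
  have h := siegel_frame_im hS hM.1
  rw [siegelNum_eq_action_mul hS hM, conjTranspose_mul, Matrix.mul_assoc, ← Matrix.mul_assoc,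
    ← Matrix.mul_assoc, ← Matrix.sub_mul, ← Matrix.mul_sub,
    sub_conjTranspose_of_symm (siegelAction_transpose hS hM), Matrix.mul_smul, Matrix.smul_mul] at h
  exact smul_right_injective _ (by simp) h

theorem siegelAction_mem {S : PhaseMatrix n} (hS : S ∈ symplecticGroup (Fin n) ℝ)
    {M : Matrix (Fin n) (Fin n) ℂ} (hM : M ∈ siegel n) : siegelAction S M ∈ siegel n := by
  refine ⟨siegelAction_transpose hS hM, posDef_of_map_ofReal ?_⟩
  have hu : IsUnit (siegelDenom S M).det := isUnit_iff_ne_zero.2 (siegelDenom_det_ne_zero hS hM)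
  have hu' : IsUnit (siegelDenom S M)ᴴ.det := by rw [det_conjTranspose]; exact hu.star
  have hi : ((siegelAction S M).map Complex.im).map Complex.ofReal
      = ((siegelDenom S M)⁻¹)ᴴ * (M.map Complex.im).map Complex.ofReal * (siegelDenom S M)⁻¹ := by
    rw [← siegelDenom_conj_im_action hS hM, conjTranspose_nonsing_inv]
    simp only [Matrix.mul_assoc]
    rw [mul_nonsing_inv _ hu, Matrix.mul_one, nonsing_inv_mul_cancel_left _ _ hu']
  rw [hi]
  refine (posDef_map_ofReal hM.2).conjTranspose_mul_mul_same ?_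
  exact mulVec_injective_of_isUnit ((isUnit_iff_isUnit_det _).2 ((isUnit_nonsing_inv_det_iff).2 hu))

theorem det_im_siegelAction {S : PhaseMatrix n} (hS : S ∈ symplecticGroup (Fin n) ℝ)
    {M : Matrix (Fin n) (Fin n) ℂ} (hM : M ∈ siegel n) :
    ‖(siegelDenom S M).det‖ ^ 2 * ((siegelAction S M).map Complex.im).det
      = (M.map Complex.im).det := by
  have h := congrArg det (siegelDenom_conj_im_action hS hM)
  rw [det_mul, det_mul, det_map_ofReal, det_map_ofReal, det_conjTranspose] at h
  have h2 : star (siegelDenom S M).det * (siegelDenom S M).det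
      = ((‖(siegelDenom S M).det‖ ^ 2 : ℝ) : ℂ) := by
    rw [Complex.star_def, Complex.conj_mul', Complex.ofReal_pow]
  rw [mul_right_comm, h2, ← Complex.ofReal_mul] at h
  exact_mod_cast h

theorem siegelDenom_siegelNum_mul (S T : PhaseMatrix n) (M : Matrix (Fin n) (Fin n) ℂ) :
    siegelDenom (S * T) M = S.toBlocks₁₁.map Complex.ofReal * siegelDenom T M
        + S.toBlocks₁₂.map Complex.ofReal * siegelNum T M ∧
    siegelNum (S * T) M = S.toBlocks₂₁.map Complex.ofReal * siegelDenom T M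
        + S.toBlocks₂₂.map Complex.ofReal * siegelNum T M := by
  have e := fromBlocks_multiply S.toBlocks₁₁ S.toBlocks₁₂ S.toBlocks₂₁ S.toBlocks₂₂
    T.toBlocks₁₁ T.toBlocks₁₂ T.toBlocks₂₁ T.toBlocks₂₂
  rw [fromBlocks_toBlocks, fromBlocks_toBlocks] at e
  constructor
  · rw [siegelDenom, e]
    simp only [toBlocks_fromBlocks₁₁, toBlocks_fromBlocks₁₂, map_ofReal_mul, map_ofReal_add,
      siegelDenom, siegelNum]
    noncomm_ring
  · rw [siegelNum, e]
    simp only [toBlocks_fromBlocks₂₁, toBlocks_fromBlocks₂₂, map_ofReal_mul, map_ofReal_add,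
      siegelDenom, siegelNum]
    noncomm_ring

/-- The cocycle rule: the frame of `S * T` is `S` applied to the frame of `T`, and the latter is
`(1, α(T)M)` times `siegelDenom T M`. -/
theorem siegelDenom_mul (S : PhaseMatrix n) {T : PhaseMatrix n}
    (hT : T ∈ symplecticGroup (Fin n) ℝ) {M : Matrix (Fin n) (Fin n) ℂ} (hM : M ∈ siegel n) :
    siegelDenom (S * T) M = siegelDenom S (siegelAction T M) * siegelDenom T M := by
  rw [(siegelDenom_siegelNum_mul S T M).1, siegelNum_eq_action_mul hT hM]
  change _ = (S.toBlocks₁₁.map Complex.ofReal + S.toBlocks₁₂.map Complex.ofReal *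
    siegelAction T M) * siegelDenom T M
  rw [Matrix.add_mul, Matrix.mul_assoc _ (siegelAction T M)]

theorem siegelAction_mul (S : PhaseMatrix n) {T : PhaseMatrix n}
    (hT : T ∈ symplecticGroup (Fin n) ℝ) {M : Matrix (Fin n) (Fin n) ℂ} (hM : M ∈ siegel n) :
    siegelAction (S * T) M = siegelAction S (siegelAction T M) := by
  have hu : IsUnit (siegelDenom T M).det := isUnit_iff_ne_zero.2 (siegelDenom_det_ne_zero hT hM)
  have h : siegelNum (S * T) M = siegelNum S (siegelAction T M) * siegelDenom T M := by
    rw [(siegelDenom_siegelNum_mul S T M).2, siegelNum_eq_action_mul hT hM]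
    change _ = (S.toBlocks₂₁.map Complex.ofReal + S.toBlocks₂₂.map Complex.ofReal *
      siegelAction T M) * siegelDenom T M
    rw [Matrix.add_mul, Matrix.mul_assoc _ (siegelAction T M)]
  rw [siegelAction_eq, h, siegelDenom_mul S hT hM, Matrix.mul_inv_rev,
    siegelAction_eq S (siegelAction T M), Matrix.mul_assoc, mul_nonsing_inv_cancel_left _ _ hu]

theorem siegelDenom_one (M : Matrix (Fin n) (Fin n) ℂ) : siegelDenom 1 M = 1 := by
  rw [siegelDenom, ← fromBlocks_one, toBlocks_fromBlocks₁₁, toBlocks_fromBlocks₁₂]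
  simp [Matrix.map_zero]

theorem siegelAction_one (M : Matrix (Fin n) (Fin n) ℂ) : siegelAction 1 M = M := by
  rw [siegelAction_eq, siegelDenom_one, siegelNum, ← fromBlocks_one, toBlocks_fromBlocks₂₁,
    toBlocks_fromBlocks₂₂]
  simp [Matrix.map_zero]

/-! ### Gaussian integrals with a complex quadratic exponent -/

theorem eq_re_add_I_smul_im (N : Matrix (Fin n) (Fin n) ℂ) :
    N = (N.map Complex.re).map Complex.ofReal
      + Complex.I • (N.map Complex.im).map Complex.ofReal := by
  ext i j
  simp [mul_comm Complex.I, Complex.re_add_im]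

/-- Simultaneous diagonalization of the real and imaginary parts of a point of the Siegel
half-space by a real congruence. -/
theorem exists_congruence_diagonal {N : Matrix (Fin n) (Fin n) ℂ} (hN : N ∈ siegel n) :
    ∃ (G : Matrix (Fin n) (Fin n) ℝ) (r : Fin n → ℝ), G.det ≠ 0 ∧
      Gᵀ.map Complex.ofReal * N * G.map Complex.ofReal
        = diagonal fun j => (r j : ℂ) + Complex.I := by
  obtain ⟨C, hC, hY⟩ := exists_transpose_mul_self hN.2
  have hCt : IsUnit Cᵀ.det := by rwa [det_transpose]
  set R := N.map Complex.re with hR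
  have hRs : Rᵀ = R := by
    rw [hR, ← transpose_map, hN.1]
  have hR' : ((C⁻¹)ᵀ * R * C⁻¹).IsHermitian := by
    rw [Matrix.IsHermitian, conjTranspose_eq_transpose_of_trivial, transpose_mul, transpose_mul,
      transpose_transpose, hRs, Matrix.mul_assoc]
  set U : Matrix (Fin n) (Fin n) ℝ := (hR'.eigenvectorUnitary).1 with hU
  have hUU : Uᵀ * U = 1 := by
    rw [← conjTranspose_eq_transpose_of_trivial, ← star_eq_conjTranspose]
    exact Unitary.coe_star_mul_self hR'.eigenvectorUnitary
  have hUd : U.det ≠ 0 := by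
    intro h0
    have := congrArg det hUU
    rw [det_mul, h0, mul_zero, det_one] at this
    exact zero_ne_one this
  have hdiag : Uᵀ * ((C⁻¹)ᵀ * R * C⁻¹) * U = diagonal hR'.eigenvalues := by
    have h := hR'.conjStarAlgAut_star_eigenvectorUnitary
    rw [Unitary.conjStarAlgAut_star_apply] at h
    rw [← conjTranspose_eq_transpose_of_trivial U, ← star_eq_conjTranspose]
    simpa [Function.comp_def] using h
  -- `C⁻¹` normalizes the imaginary part to `1`; the orthogonal `U` then diagonalizes the real part
  -- and leaves `1` unchanged.
  refine ⟨C⁻¹ * U, hR'.eigenvalues, ?_, ?_⟩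
  · rw [det_mul]
    exact mul_ne_zero (isUnit_nonsing_inv_det_iff.2 hC).ne_zero hUd
  · have e1 : (C⁻¹ * U)ᵀ * R * (C⁻¹ * U) = diagonal hR'.eigenvalues := by
      rw [← hdiag, transpose_mul]; simp only [Matrix.mul_assoc]
    have e2 : (C⁻¹ * U)ᵀ * N.map Complex.im * (C⁻¹ * U) = 1 := by
      rw [hY, transpose_mul, transpose_nonsing_inv, ← hUU]
      simp only [Matrix.mul_assoc]
      rw [mul_nonsing_inv_cancel_left _ _ hC, nonsing_inv_mul_cancel_left _ _ hCt]
    conv_lhs => rw [eq_re_add_I_smul_im N]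
    rw [Matrix.mul_add, Matrix.add_mul, Matrix.mul_smul, Matrix.smul_mul, ← map_ofReal_mul,
      ← map_ofReal_mul, ← map_ofReal_mul, ← map_ofReal_mul, e1, e2, map_ofReal_one,
      diagonal_map Complex.ofReal_zero, smul_one_eq_diagonal, diagonal_add]

theorem integral_comp_mulVec {E : Type*} [NormedAddCommGroup E] [NormedSpace ℝ E]
    {G : Matrix (Fin n) (Fin n) ℝ} (hG : G.det ≠ 0) {f : (Fin n → ℝ) → E} (hf : Continuous f) :
    ∫ v, f (G.mulVec v) = |G.det|⁻¹ • ∫ u, f u := by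
  have h := Real.map_matrix_volume_pi_eq_smul_volume_pi hG
  have h2 : ∫ u, f u ∂(Measure.map (toLin' G) volume) = ∫ v, f (G.mulVec v) := by
    rw [integral_map (Continuous.measurable (toLin' G).continuous_of_finiteDimensional).aemeasurable
      hf.aestronglyMeasurable]
    rfl
  rw [← h2, h, integral_smul_measure, ENNReal.toReal_ofReal (abs_nonneg _), abs_inv]

theorem ofReal_mulVec (G : Matrix (Fin n) (Fin n) ℝ) (v : Fin n → ℝ) :
    (fun i => ((G.mulVec v) i : ℂ)) = (G.map Complex.ofReal).mulVec fun i => (v i : ℂ) := by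
  ext i; simp [mulVec, dotProduct]

theorem dotProduct_congruence {R : Type*} [CommRing R] {m : Type*} [Fintype m]
    (G N : Matrix m m R) (v : m → R) :
    G.mulVec v ⬝ᵥ N.mulVec (G.mulVec v) = v ⬝ᵥ (Gᵀ * N * G).mulVec v := by
  rw [← mulVec_mulVec, ← mulVec_mulVec, dotProduct_mulVec v, vecMul_transpose]

theorem dotProduct_diagonal_mulVec {R : Type*} [CommRing R] {m : Type*} [Fintype m]
    [DecidableEq m] (d v : m → R) :
    v ⬝ᵥ (diagonal d).mulVec v = ∑ i, d i * v i ^ 2 := by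
  simp only [dotProduct, mulVec_diagonal]
  exact Finset.sum_congr rfl fun i _ => by ring

theorem ofReal_add_I_ne_zero (r : ℝ) : (r : ℂ) + Complex.I ≠ 0 := by
  intro h
  simpa using congrArg Complex.im h

theorem det_ne_zero_of_mem_siegel {N : Matrix (Fin n) (Fin n) ℂ} (hN : N ∈ siegel n) :
    N.det ≠ 0 := by
  obtain ⟨G, r, -, hD⟩ := exists_congruence_diagonal hN
  have h := congrArg det hD
  rw [det_mul, det_mul, det_diagonal] at h
  intro h0
  rw [h0, mul_zero, zero_mul, eq_comm, Finset.prod_eq_zero_iff] at h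
  obtain ⟨i, -, hi⟩ := h
  exact ofReal_add_I_ne_zero _ hi

/-- The Fourier transform of a complex Gaussian, with the square of its normalization. -/
theorem exists_integral_gaussian {ħ : ℝ} (hħ : 0 < ħ) {N : Matrix (Fin n) (Fin n) ℂ}
    (hN : N ∈ siegel n) :
    ∃ Z : ℂ, Z ^ 2 = (2 * Real.pi * ħ : ℂ) ^ n / ((-Complex.I) ^ n * N.det) ∧
      ∀ y : Fin n → ℝ, ∫ u : Config n, Complex.exp (Complex.I / (2 * ħ) * quad N u
          - Complex.I / ħ * ((y ⬝ᵥ u.ofLp : ℝ) : ℂ))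
        = Z * Complex.exp (-(Complex.I / (2 * ħ) * quad N⁻¹ (WithLp.toLp 2 y))) := by
  obtain ⟨G, r, hG, hD⟩ := exists_congruence_diagonal hN
  have hħ' : (ħ : ℂ) ≠ 0 := by exact_mod_cast hħ.ne'
  set Gc := G.map Complex.ofReal with hGc
  have hGt : Gᵀ.map Complex.ofReal = Gcᵀ := by rw [hGc, transpose_map]
  rw [hGt] at hD
  have hGu : IsUnit Gc.det := by
    rw [hGc, det_map_ofReal, isUnit_iff_ne_zero]; exact_mod_cast hG
  have hGtu : IsUnit Gcᵀ.det := by rwa [det_transpose]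
  have hne : ∀ j, (r j : ℂ) + Complex.I ≠ 0 := fun j => ofReal_add_I_ne_zero _
  -- In the diagonal coordinates the exponent is `-∑ b j * v j ^ 2`, and `b j` has real part `1 /
  -- (2ħ) > 0`.
  set b : Fin n → ℂ := fun j => -(Complex.I / (2 * ħ)) * (r j + Complex.I) with hb
  have hb' : ∀ j, b j = (((1 / (2 * ħ) : ℝ)) : ℂ) * (1 - r j * Complex.I) := by
    intro j
    simp only [hb]; push_cast
    linear_combination (-(1 / (2 * (ħ : ℂ)))) * Complex.I_mul_I
  have hbre : ∀ j, 0 < (b j).re := by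
    intro j
    rw [hb', Complex.re_ofReal_mul]
    simp [hħ]
  -- The Jacobian times the one-dimensional Gaussian constants. A product of principal roots need
  -- not be the principal root of the product, so only the square of `Z` is expressed through
  -- `N.det`.
  refine ⟨(|G.det| : ℝ) * ∏ j, (Real.pi / b j) ^ (1 / 2 : ℂ), ?_, fun y => ?_⟩
  · rw [mul_pow, ← Finset.prod_pow]
    have h1 : ∀ j, ((Real.pi / b j : ℂ) ^ (1 / 2 : ℂ)) ^ 2
        = (2 * Real.pi * ħ : ℂ) / (-Complex.I * (r j + Complex.I)) := by
      intro j
      rw [← Complex.cpow_nat_mul]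
      norm_num
      have := hne j
      simp only [hb]
      field_simp
    have h2 : (((|G.det| : ℝ) : ℂ)) ^ 2 * N.det = ∏ j, ((r j : ℂ) + Complex.I) := by
      rw [← det_diagonal, ← hD, det_mul, det_mul, det_transpose, hGc, det_map_ofReal,
        ← Complex.ofReal_pow, sq_abs]
      push_cast; ring
    rw [Finset.prod_congr rfl fun j _ => h1 j, Finset.prod_div_distrib, Finset.prod_const,
      Finset.prod_mul_distrib, Finset.prod_const, ← h2, Finset.card_univ, Fintype.card_fin]
    have h3 : N.det ≠ 0 := det_ne_zero_of_mem_siegel hN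
    have h4 : (((|G.det| : ℝ) : ℂ)) ≠ 0 := by exact_mod_cast abs_ne_zero.2 hG
    have h5 : (-Complex.I) ^ n ≠ 0 := pow_ne_zero _ (neg_ne_zero.2 Complex.I_ne_zero)
    field_simp
  · set f : (Fin n → ℝ) → ℂ := fun u => Complex.exp (Complex.I / (2 * ħ) *
      ((fun i => (u i : ℂ)) ⬝ᵥ N.mulVec fun i => (u i : ℂ))
          - Complex.I / ħ * ((y ⬝ᵥ u : ℝ) : ℂ)) with hf
    have hcont : Continuous f := by
      simp only [hf, dotProduct, mulVec]
      fun_prop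
    have e1 : ∫ u : Config n, Complex.exp (Complex.I / (2 * ħ) * quad N u
          - Complex.I / ħ * ((y ⬝ᵥ u.ofLp : ℝ) : ℂ)) = ∫ u, f u := by
      rw [← (PiLp.volume_preserving_ofLp (Fin n)).integral_comp
        (MeasurableEquiv.toLp 2 _).symm.measurableEmbedding]
      rfl
    have e2 : ∫ u, f u = (|G.det| : ℝ) * ∫ v, f (G.mulVec v) := by
      rw [integral_comp_mulVec hG hcont, Complex.real_smul, ← mul_assoc, ← Complex.ofReal_mul,
        mul_inv_cancel₀ (abs_ne_zero.2 hG), Complex.ofReal_one, one_mul]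
    set g : Fin n → ℝ := Gᵀ.mulVec y with hg
    have e3 : ∀ v, f (G.mulVec v) = Complex.exp (-∑ j, b j * (v j : ℂ) ^ 2
        + ∑ j, (-(Complex.I / ħ) * g j) * v j) := by
      intro v
      simp only [hf]
      rw [ofReal_mulVec, dotProduct_congruence, ← hGc, hD, dotProduct_diagonal_mulVec,
        dotProduct_mulVec, ← mulVec_transpose, ← hg]
      congr 1
      simp only [hb, dotProduct, Complex.ofReal_sum, Complex.ofReal_mul, Finset.mul_sum]
      rw [sub_eq_add_neg, ← Finset.sum_neg_distrib, ← Finset.sum_neg_distrib]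
      congr 1 <;> exact Finset.sum_congr rfl fun j _ => by ring
    have e4 : quad N⁻¹ (WithLp.toLp 2 y) = ∑ j, ((r j : ℂ) + Complex.I)⁻¹ * (g j : ℂ) ^ 2 := by
      have hN' : N⁻¹ = Gcᵀᵀ * (diagonal fun j => ((r j : ℂ) + Complex.I)⁻¹) * Gcᵀ := by
        refine Matrix.inv_eq_left_inv ?_
        have hN2 : N = Gcᵀ⁻¹ * (diagonal fun j => (r j : ℂ) + Complex.I) * Gc⁻¹ := by
          rw [← hD]; simp only [Matrix.mul_assoc]
          rw [nonsing_inv_mul_cancel_left _ _ hGtu, mul_nonsing_inv _ hGu, Matrix.mul_one]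
        have hdd : (diagonal fun j => ((r j : ℂ) + Complex.I)⁻¹) *
            (diagonal fun j => (r j : ℂ) + Complex.I) = 1 := by
          rw [diagonal_mul_diagonal, ← diagonal_one]
          congr 1; ext j; exact inv_mul_cancel₀ (hne j)
        rw [hN2, transpose_transpose]
        calc _ = Gc * ((diagonal fun j => ((r j : ℂ) + Complex.I)⁻¹) * (Gcᵀ * Gcᵀ⁻¹) *
            (diagonal fun j => (r j : ℂ) + Complex.I)) * Gc⁻¹ := by simp only [Matrix.mul_assoc]
          _ = 1 := by
            rw [mul_nonsing_inv _ hGtu, Matrix.mul_one, hdd, Matrix.mul_one, mul_nonsing_inv _ hGu]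
      rw [quad, hN', ← dotProduct_congruence, ← hGt, ← ofReal_mulVec, dotProduct_diagonal_mulVec]
    rw [e1, e2, integral_congr_ae (ae_of_all _ e3), GaussianFourier.integral_cexp_neg_sum_mul_add hbre,
      Finset.prod_mul_distrib, ← Complex.exp_sum, mul_assoc, e4]
    congr 3
    rw [Finset.mul_sum, ← Finset.sum_neg_distrib]
    refine Finset.sum_congr rfl fun j _ => ?_
    have := hne j
    simp only [hb]
    field_simp
    ring

/-! ### Gaussian states and their integrability -/

/-- The normalization constant of the Gaussian `φ_M`. -/
noncomputable def gaussConst (ħ : ℝ) (M : Matrix (Fin n) (Fin n) ℂ) : ℝ :=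
  (1 / (Real.pi * ħ)) ^ ((n : ℝ) / 4) * (M.map Complex.im).det ^ (1 / 4 : ℝ)

theorem gaussFun_eq (ħ : ℝ) (M : Matrix (Fin n) (Fin n) ℂ) (x : Config n) :
    gaussFun ħ M x = (gaussConst ħ M : ℂ) * Complex.exp (Complex.I / (2 * ħ) * quad M x) := rfl

theorem gaussConst_pos {ħ : ℝ} (hħ : 0 < ħ) {M : Matrix (Fin n) (Fin n) ℂ} (hM : M ∈ siegel n) :
    0 < gaussConst ħ M := by
  have := hM.2.det_pos
  unfold gaussConst
  positivity

/-- The Gaussian `φ_M` as an element of `L²(ℝⁿ)`. -/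
noncomputable def gaussState {ħ : ℝ} (hħ : 0 < ħ) {M : Matrix (Fin n) (Fin n) ℂ}
    (hM : M ∈ siegel n) : L2 n :=
  (memLp_gaussFun hħ hM).toLp (gaussFun ħ M)

theorem coeFn_gaussState {ħ : ℝ} (hħ : 0 < ħ) {M : Matrix (Fin n) (Fin n) ℂ} (hM : M ∈ siegel n) :
    gaussState hħ hM =ᵐ[volume] gaussFun ħ M :=
  MemLp.coeFn_toLp _

theorem quad_add (A B : Matrix (Fin n) (Fin n) ℂ) (x : Config n) :
    quad (A + B) x = quad A x + quad B x := by
  simp [quad, add_mulVec]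

theorem quad_sub (A B : Matrix (Fin n) (Fin n) ℂ) (x : Config n) :
    quad (A - B) x = quad A x - quad B x := by
  simp [quad, sub_mulVec]

theorem quad_smul_right (M : Matrix (Fin n) (Fin n) ℂ) (a : ℝ) (x : Config n) :
    quad M (a • x) = (a : ℂ) ^ 2 * quad M x := by
  have : (fun i => ((a • x) i : ℂ)) = (a : ℂ) • fun i => (x i : ℂ) := by
    ext i; simp
  rw [quad, this, mulVec_smul, smul_dotProduct, dotProduct_smul, quad, smul_eq_mul, smul_eq_mul]
  ring

theorem quad_map_ofReal (A : Matrix (Fin n) (Fin n) ℝ) (x : Config n) :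
    quad (A.map Complex.ofReal) x = ((A.mulVec x.ofLp ⬝ᵥ x.ofLp : ℝ) : ℂ) := by
  rw [quad, ← ofReal_mulVec]
  simp [dotProduct, mul_comm]

theorem quad_congruence (L : Matrix (Fin n) (Fin n) ℝ) (N : Matrix (Fin n) (Fin n) ℂ)
    (x : Config n) :
    quad (Lᵀ.map Complex.ofReal * N * L.map Complex.ofReal) x
      = quad N (WithLp.toLp 2 (L.mulVec x.ofLp)) := by
  rw [transpose_map, quad, quad, ← dotProduct_congruence, ← ofReal_mulVec]

theorem continuous_quad (M : Matrix (Fin n) (Fin n) ℂ) : Continuous (quad M) := by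
  unfold quad
  simp only [dotProduct, mulVec]
  fun_prop

theorem integrable_gaussFun {ħ : ℝ} (hħ : 0 < ħ) {M : Matrix (Fin n) (Fin n) ℂ}
    (hM : M ∈ siegel n) : Integrable (gaussFun ħ M) (volume : Measure (Config n)) := by
  obtain ⟨c, hc, hq⟩ := exists_pos_le_quad hM
  have hcont : Continuous (gaussFun ħ M) := by
    simp only [funext (gaussFun_eq ħ M)]
    exact continuous_const.mul (Complex.continuous_exp.comp
      (continuous_const.mul (continuous_quad M)))
  have hint : Integrable (fun x : Config n =>
      gaussConst ħ M * Real.exp (-(c / (2 * ħ)) * ‖x‖ ^ 2)) := by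
    have h := (GaussianFourier.integrable_cexp_neg_mul_sq_norm_add (V := Config n)
      (b := ((c / (2 * ħ) : ℝ) : ℂ)) (by rw [Complex.ofReal_re]; positivity) 0 0).norm
    refine Integrable.const_mul (h.congr (ae_of_all _ fun x => ?_)) _
    simp only [Complex.norm_exp]
    congr 1
    rw [zero_mul, add_zero, ← Complex.ofReal_pow, ← Complex.ofReal_neg, ← Complex.ofReal_mul,
      Complex.ofReal_re]
  refine hint.mono' hcont.aestronglyMeasurable (ae_of_all _ fun x => ?_)
  have hre : (Complex.I / (2 * ħ) * quad M x).re = -((quad M x).im / (2 * ħ)) := by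
    have : Complex.I / (2 * ħ) * quad M x = ((1 / (2 * ħ) : ℝ) : ℂ) * (Complex.I * quad M x) := by
      push_cast; ring
    rw [this, Complex.re_ofReal_mul]
    simp
    ring
  rw [gaussFun_eq, norm_mul, Complex.norm_exp, hre, Complex.norm_real,
    Real.norm_of_nonneg (gaussConst_pos hħ hM).le]
  refine mul_le_mul_of_nonneg_left (Real.exp_le_exp.mpr ?_) (gaussConst_pos hħ hM).le
  have : c * ‖x‖ ^ 2 / (2 * ħ) ≤ (quad M x).im / (2 * ħ) :=
    div_le_div_of_nonneg_right (hq x) (by positivity)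
  calc -((quad M x).im / (2 * ħ)) ≤ -(c * ‖x‖ ^ 2 / (2 * ħ)) := neg_le_neg this
    _ = -(c / (2 * ħ)) * ‖x‖ ^ 2 := by ring

theorem integrable_gaussState {ħ : ℝ} (hħ : 0 < ħ) {M : Matrix (Fin n) (Fin n) ℂ}
    (hM : M ∈ siegel n) : Integrable (gaussState hħ hM) (volume : Measure (Config n)) :=
  (integrable_gaussFun hħ hM).congr (coeFn_gaussState hħ hM).symm

theorem genFourier_congr (ħ : ℝ) (P L Q : Matrix (Fin n) (Fin n) ℝ) (m : ℤ)
    {ψ φ : Config n → ℂ} (h : ψ =ᵐ[volume] φ) :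
    genFourier ħ P L Q m ψ = genFourier ħ P L Q m φ := by
  ext x
  unfold genFourier
  congr 1
  exact integral_congr_ae (h.mono fun u hu => by simp only [hu])

/-! ### Action of the generators on Gaussians -/

theorem map_ofReal_add_mem_siegel {Q : Matrix (Fin n) (Fin n) ℝ} (hQ : Qᵀ = Q)
    {M : Matrix (Fin n) (Fin n) ℂ} (hM : M ∈ siegel n) :
    Q.map Complex.ofReal + M ∈ siegel n := by
  refine ⟨?_, ?_⟩
  · rw [transpose_add, hM.1, ← transpose_map, hQ]
  · have : (Q.map Complex.ofReal + M).map Complex.im = M.map Complex.im := by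
      ext i j; simp
    rw [this]; exact hM.2

theorem siegelDenom_freeSymplectic (P L Q : Matrix (Fin n) (Fin n) ℝ)
    (M : Matrix (Fin n) (Fin n) ℂ) :
    siegelDenom (freeSymplectic P L Q) M
      = L⁻¹.map Complex.ofReal * (Q.map Complex.ofReal + M) := by
  rw [siegelDenom, freeSymplectic, toBlocks_fromBlocks₁₁, toBlocks_fromBlocks₁₂, map_ofReal_mul,
    Matrix.mul_add]

theorem map_ofReal_inv_mul {L : Matrix (Fin n) (Fin n) ℝ} (hL : L.det ≠ 0) :
    L⁻¹.map Complex.ofReal * L.map Complex.ofReal = 1 := by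
  rw [← map_ofReal_mul, nonsing_inv_mul _ (isUnit_iff_ne_zero.2 hL), map_ofReal_one]

/-- This is the form in which the new exponent appears: integrating out `x'` completes the square
for `Q + M` and leaves `P - Lᵀ (Q + M)⁻¹ L`. -/
theorem siegelAction_freeSymplectic (P : Matrix (Fin n) (Fin n) ℝ)
    {L Q : Matrix (Fin n) (Fin n) ℝ} (hL : L.det ≠ 0) (hQ : Qᵀ = Q)
    {M : Matrix (Fin n) (Fin n) ℂ} (hM : M ∈ siegel n) :
    siegelAction (freeSymplectic P L Q) M = P.map Complex.ofReal
      - Lᵀ.map Complex.ofReal * (Q.map Complex.ofReal + M)⁻¹ * L.map Complex.ofReal := by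
  have hN : IsUnit (Q.map Complex.ofReal + M).det :=
    isUnit_iff_ne_zero.2 (det_ne_zero_of_mem_siegel (map_ofReal_add_mem_siegel hQ hM))
  have hLi := map_ofReal_inv_mul hL
  have hLi' := mul_eq_one_comm.1 hLi
  have hd : (siegelDenom (freeSymplectic P L Q) M)⁻¹
      = (Q.map Complex.ofReal + M)⁻¹ * L.map Complex.ofReal := by
    rw [siegelDenom_freeSymplectic]
    refine Matrix.inv_eq_left_inv ?_
    rw [Matrix.mul_assoc, ← Matrix.mul_assoc (L.map _), hLi', Matrix.one_mul,
      nonsing_inv_mul _ hN]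
  have hnum : siegelNum (freeSymplectic P L Q) M
      = P.map Complex.ofReal * L⁻¹.map Complex.ofReal * (Q.map Complex.ofReal + M)
        - Lᵀ.map Complex.ofReal := by
    rw [siegelNum, freeSymplectic, toBlocks_fromBlocks₂₁, toBlocks_fromBlocks₂₂, sub_eq_add_neg,
      map_ofReal_add, map_ofReal_mul, map_ofReal_mul, Matrix.mul_add, Matrix.map_neg _ Complex.ofReal_neg]
    abel
  rw [siegelAction_eq, hnum, hd, Matrix.sub_mul, ← Matrix.mul_assoc, ← Matrix.mul_assoc,
    mul_nonsing_inv_cancel_right _ _ hN, Matrix.mul_assoc, hLi, Matrix.mul_one]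

/-- By `det_im_siegelAction` the ratio is the fourth root of `|det(A + BM)|²`. It supplies the
modulus in the numerator of the squared phase. -/
theorem sq_gaussConst_div {ħ : ℝ} (hħ : 0 < ħ) {S : PhaseMatrix n}
    (hS : S ∈ symplecticGroup (Fin n) ℝ) {M : Matrix (Fin n) (Fin n) ℂ} (hM : M ∈ siegel n) :
    (gaussConst ħ M / gaussConst ħ (siegelAction S M)) ^ 2 = ‖(siegelDenom S M).det‖ := by
  have h1 := (siegelAction_mem hS hM).2.det_pos
  have hd : 0 ≤ ‖(siegelDenom S M).det‖ := norm_nonneg _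
  rw [gaussConst, gaussConst, ← det_im_siegelAction hS hM, Real.mul_rpow (by positivity) h1.le,
    mul_div_mul_left _ _ (by positivity), mul_div_cancel_right₀ _ (by positivity),
    ← Real.rpow_natCast, ← Real.rpow_natCast, ← Real.rpow_mul hd, ← Real.rpow_mul hd]
  norm_num

/-- The phase of the generator `Ŝ_{W,m}` on the Gaussian `φ_M`. -/
theorem exists_genFourier_gaussFun {ħ : ℝ} (hħ : 0 < ħ) {P L Q : Matrix (Fin n) (Fin n) ℝ} {m : ℤ}
    (hQ : Qᵀ = Q) (hL : 0 < (-1 : ℝ) ^ m * L.det)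
    (hS : freeSymplectic P L Q ∈ symplecticGroup (Fin n) ℝ)
    {M : Matrix (Fin n) (Fin n) ℂ} (hM : M ∈ siegel n) :
    ∃ c : ℂ, c ^ 2 = (‖(siegelDenom (freeSymplectic P L Q) M).det‖ : ℂ)
        / (siegelDenom (freeSymplectic P L Q) M).det ∧
      ∀ x, genFourier ħ P L Q m (gaussFun ħ M) x
        = c * gaussFun ħ (siegelAction (freeSymplectic P L Q) M) x := by
  have hL0 : L.det ≠ 0 := fun h => by simp [h] at hL
  have hLc : (L.det : ℂ) ≠ 0 := by exact_mod_cast hL0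
  have hħ' : (ħ : ℂ) ≠ 0 := by exact_mod_cast hħ.ne'
  have hπ : (Real.pi : ℂ) ≠ 0 := by exact_mod_cast Real.pi_ne_zero
  have hNs := map_ofReal_add_mem_siegel hQ hM
  set N := Q.map Complex.ofReal + M with hN
  have hN0 : N.det ≠ 0 := det_ne_zero_of_mem_siegel hNs
  set M' := siegelAction (freeSymplectic P L Q) M with hM'
  have hk' : (gaussConst ħ M' : ℂ) ≠ 0 := by
    exact_mod_cast (gaussConst_pos hħ (siegelAction_mem hS hM)).ne'
  obtain ⟨Z, hZ, hint⟩ := exists_integral_gaussian hħ hNs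
  set pref : ℂ := (1 / (2 * (Real.pi : ℂ) * Complex.I * (ħ : ℂ))) ^ ((n : ℂ) / 2) * Complex.I ^ m
    * ((√|L.det| : ℝ) : ℂ) with hpref
  -- Here the condition on `m` enters: `i^(2m) = (-1)^m` restores the sign lost in `|det L|`.
  have hpref2 : pref ^ 2 = (1 / (2 * (Real.pi : ℂ) * Complex.I * (ħ : ℂ))) ^ n * L.det := by
    have h1 : (-1 : ℝ) ^ m * |L.det| = L.det := by
      rcases Int.even_or_odd m with h | h <;> rw [h.neg_one_zpow] at hL ⊢
      · rw [one_mul] at hL ⊢; exact abs_of_pos hL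
      · rw [abs_of_neg (by linarith)]; ring
    have h2 : (Complex.I ^ m) ^ 2 = (((-1 : ℝ) ^ m : ℝ) : ℂ) := by
      rw [← zpow_natCast, ← _root_.zpow_mul, mul_comm, _root_.zpow_mul]
      simp
    have h3 : (((√|L.det| : ℝ) : ℂ)) ^ 2 = ((|L.det| : ℝ) : ℂ) := by
      rw [← Complex.ofReal_pow, Real.sq_sqrt (abs_nonneg _)]
    rw [hpref, mul_pow, mul_pow, h2, h3, mul_assoc, ← Complex.ofReal_mul, h1,
      ← Complex.cpow_nat_mul]
    congr 1
    rw [show ((2 : ℕ) : ℂ) * ((n : ℂ) / 2) = (n : ℂ) by push_cast; ring, Complex.cpow_natCast]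
  have hdet : (siegelDenom (freeSymplectic P L Q) M).det = N.det / L.det := by
    rw [siegelDenom_freeSymplectic, det_mul, det_map_ofReal, det_nonsing_inv,
      Ring.inverse_eq_inv', Complex.ofReal_inv, ← hN, inv_mul_eq_div]
  refine ⟨pref * (gaussConst ħ M * Z) / gaussConst ħ M', ?_, fun x => ?_⟩
  · have hk := congrArg (fun r : ℝ => (r : ℂ)) (sq_gaussConst_div hħ hS hM)
    simp only [← hM'] at hk
    push_cast at hk
    have : (pref * (gaussConst ħ M * Z) / gaussConst ħ M') ^ 2
        = pref ^ 2 * Z ^ 2 * ((gaussConst ħ M : ℂ) / gaussConst ħ M') ^ 2 := by ring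
    rw [this, hk, hpref2, hZ, hdet]
    -- The powers of `2πħ` cancel, and the remaining `(-i)^n` cancels the one in `Z ^ 2`.
    have hI : (1 / (2 * (Real.pi : ℂ) * Complex.I * (ħ : ℂ))) ^ n * (2 * Real.pi * ħ : ℂ) ^ n
        = (-Complex.I) ^ n := by
      rw [← mul_pow]
      congr 1
      rw [← Complex.inv_I]
      field_simp
    have hIn : (-Complex.I) ^ n ≠ 0 := pow_ne_zero _ (neg_ne_zero.2 Complex.I_ne_zero)
    calc _ = ((1 / (2 * (Real.pi : ℂ) * Complex.I * (ħ : ℂ))) ^ n * (2 * Real.pi * ħ : ℂ) ^ n)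
          / (-Complex.I) ^ n * ((‖N.det / L.det‖ : ℂ) * L.det / N.det) := by
          field_simp
      _ = _ := by rw [hI, div_self hIn]; field_simp
  · have hq : quad M' x = quad (P.map Complex.ofReal) x
        - quad N⁻¹ (WithLp.toLp 2 (L.mulVec x.ofLp)) := by
      rw [hM', siegelAction_freeSymplectic P hL0 hQ hM, quad_sub, quad_congruence]
    have e : ∀ u : Config n, Complex.exp (Complex.I / ħ * (genForm P L Q x u : ℂ)) * gaussFun ħ M u
        = (gaussConst ħ M * Complex.exp (Complex.I / (2 * ħ) * quad (P.map Complex.ofReal) x))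
          * Complex.exp (Complex.I / (2 * ħ) * quad N u
            - Complex.I / ħ * ((L.mulVec x.ofLp ⬝ᵥ u.ofLp : ℝ) : ℂ)) := by
      intro u
      rw [gaussFun_eq, mul_left_comm, mul_assoc, ← Complex.exp_add, ← Complex.exp_add, hN, quad_add,
        quad_map_ofReal, quad_map_ofReal, genForm]
      congr 2
      push_cast
      ring
    rw [genFourier, integral_congr_ae (ae_of_all _ e), integral_const_mul, hint, ← hpref,
      gaussFun_eq, hq, mul_sub, sub_eq_add_neg, Complex.exp_add]
    field_simp

/-! ### From the generators to the whole metaplectic group -/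

/-- `g` maps every Gaussian `φ_M` to the Gaussian `φ_{α(S) M}` up to the metaplectic phase. -/
def MapsGaussians {ħ : ℝ} (hħ : 0 < ħ)
    (g : (L2 n ≃ₗᵢ[ℂ] L2 n) × symplecticGroup (Fin n) ℝ) : Prop :=
  ∀ (M : Matrix (Fin n) (Fin n) ℂ) (hM : M ∈ siegel n)
    (hα : siegelAction (g.2 : PhaseMatrix n) M ∈ siegel n),
    ∃ c : ℂ, c ^ 2 = (‖(siegelDenom (g.2 : PhaseMatrix n) M).det‖ : ℂ)
        / (siegelDenom (g.2 : PhaseMatrix n) M).det ∧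
      g.1 (gaussState hħ hM) = c • gaussState hħ hα

/-- Gaussians are integrable, so the integral formula that pins down the generator applies to them.
-/
theorem mapsGaussians_of_mem_generators {ħ : ℝ} (hħ : 0 < ħ)
    {g : (L2 n ≃ₗᵢ[ℂ] L2 n) × symplecticGroup (Fin n) ℝ} (hg : g ∈ metaplecticGenerators n ħ) :
    MapsGaussians hħ g := by
  obtain ⟨P, L, Q, m, -, hQ, hL, hS, hT⟩ := hg
  have hmem : freeSymplectic P L Q ∈ symplecticGroup (Fin n) ℝ := hS ▸ g.2.2
  intro M hM
  rw [hS]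
  intro hα
  obtain ⟨c, hc, h⟩ := exists_genFourier_gaussFun hħ hQ hL hmem hM
  refine ⟨c, hc, Lp.ext ?_⟩
  refine (hT _ (integrable_gaussState hħ hM)).trans ?_
  rw [genFourier_congr ħ P L Q m (coeFn_gaussState hħ hM)]
  filter_upwards [Lp.coeFn_smul c (gaussState hħ hα), coeFn_gaussState hħ hα] with x h1 h2
  rw [h x, h1, Pi.smul_apply, h2, smul_eq_mul]

theorem MapsGaussians.mul {ħ : ℝ} {hħ : 0 < ħ}
    {g h : (L2 n ≃ₗᵢ[ℂ] L2 n) × symplecticGroup (Fin n) ℝ}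
    (hg : MapsGaussians hħ g) (hh : MapsGaussians hħ h) : MapsGaussians hħ (g * h) := by
  intro M hM
  have hS : ((g * h).2 : PhaseMatrix n) = g.2 * h.2 := rfl
  have hM1 := siegelAction_mem h.2.2 hM
  rw [hS, siegelAction_mul _ h.2.2 hM, siegelDenom_mul _ h.2.2 hM]
  intro hα
  obtain ⟨c, hc, e⟩ := hh M hM hM1
  obtain ⟨c', hc', e'⟩ := hg _ hM1 hα
  refine ⟨c * c', ?_, ?_⟩
  · rw [mul_pow, hc, hc', det_mul, norm_mul, Complex.ofReal_mul]
    ring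
  · change g.1 (h.1 _) = _
    rw [e, map_smul, e', smul_smul]

theorem MapsGaussians.one {ħ : ℝ} (hħ : 0 < ħ) :
    MapsGaussians hħ (1 : (L2 n ≃ₗᵢ[ℂ] L2 n) × symplecticGroup (Fin n) ℝ) := by
  intro M hM
  have hS : ((1 : (L2 n ≃ₗᵢ[ℂ] L2 n) × symplecticGroup (Fin n) ℝ).2 : PhaseMatrix n) = 1 := rfl
  rw [hS, siegelAction_one, siegelDenom_one]
  intro _
  exact ⟨1, by simp, by rw [one_smul]; rfl⟩

theorem MapsGaussians.inv {ħ : ℝ} {hħ : 0 < ħ}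
    {g : (L2 n ≃ₗᵢ[ℂ] L2 n) × symplecticGroup (Fin n) ℝ}
    (hg : MapsGaussians hħ g) : MapsGaussians hħ g⁻¹ := by
  intro M hM
  change ∀ hα : siegelAction ((g.2⁻¹ : symplecticGroup (Fin n) ℝ) : PhaseMatrix n) M ∈ siegel n, _
  intro hα
  have hone : (g.2 : PhaseMatrix n) * ((g.2⁻¹ : symplecticGroup (Fin n) ℝ) : PhaseMatrix n) = 1 := by
    rw [← Submonoid.coe_mul, mul_inv_cancel, Submonoid.coe_one]
  have hden := siegelDenom_mul (g.2 : PhaseMatrix n) (g.2⁻¹).2 hM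
  have hact := siegelAction_mul (g.2 : PhaseMatrix n) (g.2⁻¹).2 hM
  rw [hone, siegelDenom_one] at hden
  rw [hone, siegelAction_one] at hact
  have hdet := congrArg det hden
  rw [det_one, det_mul] at hdet
  -- The hypothesis is used at `α(g⁻¹)M`, which `g` carries back to `M`; the phase of `g⁻¹` is the
  -- inverse of the one found there.
  have key := hg _ hα
  rw [← hact] at key
  obtain ⟨c, hc, e⟩ := key hM
  set d := (siegelDenom ((g.2⁻¹ : symplecticGroup (Fin n) ℝ) : PhaseMatrix n) M).det with hd
  have hd0 : d ≠ 0 := right_ne_zero_of_mul (hdet ▸ one_ne_zero)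
  have hd' := eq_inv_of_mul_eq_one_left hdet.symm
  rw [hd', norm_inv, Complex.ofReal_inv, div_inv_eq_mul] at hc
  have hc0 : c ≠ 0 := by
    rintro rfl
    simp [hd0] at hc
  refine ⟨c⁻¹, ?_, ?_⟩
  · change _ = (‖d‖ : ℂ) / d
    rw [inv_pow, hc]
    field_simp
  · change g.1.symm _ = _
    rw [LinearIsometryEquiv.symm_apply_eq, map_smul, e, smul_smul, inv_mul_cancel₀ hc0, one_smul]

theorem mapsGaussians_of_mem_metaplecticGraph {ħ : ℝ} (hħ : 0 < ħ)
    {g : (L2 n ≃ₗᵢ[ℂ] L2 n) × symplecticGroup (Fin n) ℝ} (hg : g ∈ metaplecticGraph n ħ) :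
    MapsGaussians hħ g := by
  induction hg using Subgroup.closure_induction with
  | mem x hx => exact mapsGaussians_of_mem_generators hħ hx
  | one => exact MapsGaussians.one hħ
  | mul x y _ _ hx hy => exact hx.mul hy
  | inv x _ hx => exact hx.inv

/-! ### Continuity of the phase -/

theorem ae_comp_smul {p : Config n → Prop} (hp : ∀ᵐ x, p x) {r : ℝ} (hr : r ≠ 0) :
    ∀ᵐ x : Config n, p (r • x) := by
  refine ae_of_ae_map (f := fun x : Config n => r • x) (by fun_prop) ?_
  rw [Measure.map_addHaar_smul _ hr]
  exact Measure.ae_smul_measure hp _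

/-- At integer multiples of `x` the exponential factor is a power of one number, so it can be
eliminated between several multiples without knowing `M`. -/
theorem gaussFun_smul (ħ : ℝ) (M : Matrix (Fin n) (Fin n) ℂ) (k : ℕ) (x : Config n) :
    gaussFun ħ M ((k : ℝ) • x)
      = gaussConst ħ M * Complex.exp (Complex.I / (2 * ħ) * quad M x) ^ (k ^ 2) := by
  rw [gaussFun_eq, quad_smul_right, ← Complex.exp_nat_mul]
  congr 2
  push_cast
  ring

/-- If multiples of Gaussians by unit phases converge in `L²(ℝⁿ)` to such a multiple, then so do
the phases. -/
theorem tendsto_phase_of_tendsto_smul_gaussState {ħ : ℝ} (hħ : 0 < ħ) {ι : Type*} {u : Filter ι}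
    [u.IsCountablyGenerated] {N : ι → Matrix (Fin n) (Fin n) ℂ} (hN : ∀ j, N j ∈ siegel n)
    {c : ι → ℂ} (hc : ∀ j, ‖c j‖ = 1) {N₀ : Matrix (Fin n) (Fin n) ℂ} (hN₀ : N₀ ∈ siegel n)
    {c₀ : ℂ} (hc₀ : ‖c₀‖ = 1)
    (h : Tendsto (fun j => c j • gaussState hħ (hN j)) u (𝓝 (c₀ • gaussState hħ hN₀))) :
    Tendsto c u (𝓝 c₀) := by
  -- `L²` convergence gives convergence almost everywhere only along a subsequence, which suffices
  -- when extracted from every subsequence.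
  refine tendsto_of_subseq_tendsto fun ns hns => ?_
  obtain ⟨ms, -, hms⟩ := (tendstoInMeasure_of_tendsto_Lp (h.comp hns)).exists_seq_tendsto_ae
  refine ⟨ms, ?_⟩
  have coe : ∀ {b : ℂ} {A : Matrix (Fin n) (Fin n) ℂ} (hA : A ∈ siegel n),
      ∀ᵐ x, (b • gaussState hħ hA : L2 n) x = b * gaussFun ħ A x := by
    intro b A hA
    filter_upwards [Lp.coeFn_smul b (gaussState hħ hA), coeFn_gaussState hħ hA] with x h1 h2
    rw [h1, Pi.smul_apply, h2, smul_eq_mul]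
  have hae : ∀ᵐ x : Config n, Tendsto (fun j => c (ns (ms j)) * gaussFun ħ (N (ns (ms j))) x) atTop
      (𝓝 (c₀ * gaussFun ħ N₀ x)) := by
    filter_upwards [hms, coe hN₀, ae_all_iff.2 fun j => coe (b := c (ns (ms j))) (hN (ns (ms j)))]
      with x h1 h2 h3
    rw [← h2]
    exact h1.congr h3
  -- Dilations preserve null sets, so one point `x` has convergence at `x`, `2x` and `3x`
  -- simultaneously.
  obtain ⟨x, h1, h2, h3⟩ := ((ae_comp_smul hae (r := ((1 : ℕ) : ℝ)) (by simp)).and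
    ((ae_comp_smul hae (r := ((2 : ℕ) : ℝ)) (by simp)).and
      (ae_comp_smul hae (r := ((3 : ℕ) : ℝ)) (by simp)))).exists
  -- The exponential cancels because `9 + 3·1 - 3·4 = 0`, while the constant factor survives to the
  -- power `1 + 3 - 3 = 1`.
  have ident : ∀ (b : ℂ) (A : Matrix (Fin n) (Fin n) ℂ), A ∈ siegel n → ‖b‖ = 1 →
      b * gaussFun ħ A (((2 : ℕ) : ℝ) • x) ≠ 0 ∧
      (b * gaussFun ħ A (((3 : ℕ) : ℝ) • x)) * (b * gaussFun ħ A (((1 : ℕ) : ℝ) • x)) ^ 3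
        / (b * gaussFun ħ A (((2 : ℕ) : ℝ) • x)) ^ 3 = b * gaussConst ħ A := by
    intro b A hA hb
    have hk : (gaussConst ħ A : ℂ) ≠ 0 := by exact_mod_cast (gaussConst_pos hħ hA).ne'
    have hb0 : b ≠ 0 := fun h0 => by simp [h0] at hb
    have hE := Complex.exp_ne_zero (Complex.I / (2 * ħ) * quad A x)
    simp only [gaussFun_smul]
    refine ⟨mul_ne_zero hb0 (mul_ne_zero hk (pow_ne_zero _ hE)), ?_⟩
    generalize Complex.exp (Complex.I / (2 * ħ) * quad A x) = E at hE
    field_simp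
    ring
  have norm_eq : ∀ (b : ℂ) (A : Matrix (Fin n) (Fin n) ℂ), A ∈ siegel n → ‖b‖ = 1 →
      (b * gaussConst ħ A) / (‖b * gaussConst ħ A‖ : ℂ) = b := by
    intro b A hA hb
    have hk := gaussConst_pos hħ hA
    rw [norm_mul, hb, one_mul, Complex.norm_real, Real.norm_of_nonneg hk.le]
    exact mul_div_cancel_right₀ _ (by exact_mod_cast hk.ne')
  have hlim := (h3.mul (h1.pow 3)).div (h2.pow 3) (pow_ne_zero 3 (ident c₀ N₀ hN₀ hc₀).1)
  rw [(ident c₀ N₀ hN₀ hc₀).2] at hlim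
  have hlim' := hlim.congr fun j => (ident _ _ (hN (ns (ms j))) (hc (ns (ms j)))).2
  have hne : (‖c₀ * gaussConst ħ N₀‖ : ℂ) ≠ 0 := by
    rw [norm_mul, hc₀, one_mul, Complex.norm_real]
    exact_mod_cast norm_ne_zero_iff.2 (gaussConst_pos hħ hN₀).ne'
  -- Dividing by the modulus removes the positive constant `gaussConst` and leaves the unit phase.
  have hfin := hlim'.div ((Complex.continuous_ofReal.tendsto _).comp hlim'.norm) hne
  rw [norm_eq c₀ N₀ hN₀ hc₀] at hfin
  exact hfin.congr fun j => norm_eq _ _ (hN (ns (ms j))) (hc (ns (ms j)))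

/-! ### Metaplectic phases and the initial time -/

theorem norm_eq_one_of_sq_eq {c d : ℂ} (hd : d ≠ 0) (h : c ^ 2 = (‖d‖ : ℂ) / d) : ‖c‖ = 1 := by
  have h1 := congrArg norm h
  rw [norm_pow, norm_div, Complex.norm_real, norm_norm, div_self (norm_ne_zero_iff.2 hd)] at h1
  exact (pow_eq_one_iff_of_nonneg (norm_nonneg c) two_ne_zero).1 h1

theorem HasProjection.mem_symplecticGroup {ħ : ℝ} {Shat : L2 n ≃ₗᵢ[ℂ] L2 n} {S : PhaseMatrix n}
    (h : HasProjection ħ Shat S) : S ∈ symplecticGroup (Fin n) ℝ := by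
  obtain ⟨g, -, -, rfl⟩ := h
  exact g.2.2

/-- Metaplectic operators permute the squeezed Gaussians, up to the metaplectic phase. -/
theorem HasProjection.exists_phase {ħ : ℝ} (hħ : 0 < ħ) {Shat : L2 n ≃ₗᵢ[ℂ] L2 n}
    {S : PhaseMatrix n} (h : HasProjection ħ Shat S) {M : Matrix (Fin n) (Fin n) ℂ}
    (hM : M ∈ siegel n) (hα : siegelAction S M ∈ siegel n) :
    ∃ c : ℂ, c ^ 2 = (‖(siegelDenom S M).det‖ : ℂ) / (siegelDenom S M).det ∧
      Shat (gaussState hħ hM) = c • gaussState hħ hα := by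
  obtain ⟨g, hg, rfl, rfl⟩ := h
  exact mapsGaussians_of_mem_metaplecticGraph hħ hg M hM hα

theorem gaussState_ne_zero {ħ : ℝ} (hħ : 0 < ħ) {M : Matrix (Fin n) (Fin n) ℂ}
    (hM : M ∈ siegel n) : gaussState hħ hM ≠ 0 := by
  intro h0
  have h := coeFn_gaussState hħ hM
  rw [h0] at h
  obtain ⟨x, h1, h2⟩ := (h.and (Lp.coeFn_zero ℂ 2 (volume : Measure (Config n)))).exists
  rw [h2, gaussFun_eq] at h1
  refine mul_ne_zero ?_ (Complex.exp_ne_zero _) h1.symm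
  exact_mod_cast (gaussConst_pos hħ hM).ne'

/-- `f 0` is the identity on a whole neighbourhood of `z₀`, so its derivative there is the identity.
-/
theorem flowJacobian_zero {H : Phase n → ℝ → ℝ} {I : Set ℝ} {z₀ : Phase n}
    {f : ℝ → Phase n → Phase n} (hf : IsHamiltonianFlowNear H I z₀ f) (h0 : (0 : ℝ) ∈ I) :
    flowJacobian f z₀ 0 = 1 := by
  have hid : f 0 =ᶠ[𝓝 z₀] id := (hf 0 h0).mono fun z hz => hz.1
  have hfd : fderiv ℝ (f 0) z₀ = ContinuousLinearMap.id ℝ (Phase n) := by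
    rw [hid.fderiv_eq, fderiv_id]
  rw [flowJacobian, hfd, ← fromBlocks_one]
  congr 1 <;> ext i j <;> simp [Matrix.one_apply]

end NearbyOrbit

open NearbyOrbit
theorem mainTheorem3 (n : ℕ) (ħ : ℝ) (hħ : 0 < ħ)
    (H : Phase n → ℝ → ℝ) (hH : ContDiff ℝ 2 (fun q : Phase n × ℝ => H q.1 q.2))
    (I : Set ℝ) (hI : IsOpen I) (hI' : I.OrdConnected) (h0 : (0 : ℝ) ∈ I)
    (z₀ : Phase n) (f : ℝ → Phase n → Phase n) (hf : IsHamiltonianFlowNear H I z₀ f)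
    (Shat : ℝ → (L2 n ≃ₗᵢ[ℂ] L2 n)) (hS : IsMetaplecticLift ħ I (flowJacobian f z₀) Shat)
    (M : Matrix (Fin n) (Fin n) ℂ) (hM : M ∈ siegel n) :
    ∃ θ : ℝ → ℂ, ContinuousOn θ I ∧ θ 0 = 1 ∧ ∀ t ∈ I,
      (siegelDenom (flowJacobian f z₀ t) M).det ≠ 0 ∧
      θ t ^ 2 = (‖(siegelDenom (flowJacobian f z₀ t) M).det‖ : ℂ)
        / (siegelDenom (flowJacobian f z₀ t) M).det ∧
      ∃ hα : siegelAction (flowJacobian f z₀ t) M ∈ siegel n,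
        nearbyOrbitPropagator ħ H f Shat t z₀ (squeezedState hħ z₀ hM) =
          Complex.exp (Complex.I / ħ * (gammaPhase H f z₀ t : ℂ)) •
            θ t • squeezedState hħ (f t z₀) hα := by
  have hsymp : ∀ t ∈ I, flowJacobian f z₀ t ∈ Matrix.symplecticGroup (Fin n) ℝ :=
    fun t ht => (hS.projection t ht).mem_symplecticGroup
  have hmem : ∀ t ∈ I, siegelAction (flowJacobian f z₀ t) M ∈ siegel n :=
    fun t ht => siegelAction_mem (hsymp t ht) hM
  have hdet : ∀ t ∈ I, (siegelDenom (flowJacobian f z₀ t) M).det ≠ 0 :=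
    fun t ht => siegelDenom_det_ne_zero (hsymp t ht) hM
  -- Membership in `I` is placed under the existential so that the choice gives a function on all of
  -- `ℝ`; outside `I` the value is irrelevant.
  have hex : ∀ t, ∃ c : ℂ, ∀ ht : t ∈ I,
      c ^ 2 = (‖(siegelDenom (flowJacobian f z₀ t) M).det‖ : ℂ)
        / (siegelDenom (flowJacobian f z₀ t) M).det ∧
      Shat t (gaussState hħ hM) = c • gaussState hħ (hmem t ht) := by
    intro t
    by_cases ht : t ∈ I
    · obtain ⟨c, hc⟩ := (hS.projection t ht).exists_phase hħ hM (hmem t ht)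
      exact ⟨c, fun _ => hc⟩
    · exact ⟨0, fun h => absurd h ht⟩
  choose θ hθ using hex
  have hnorm : ∀ t ∈ I, ‖θ t‖ = 1 := fun t ht => norm_eq_one_of_sq_eq (hdet t ht) (hθ t ht).1
  refine ⟨θ, ?_, ?_, fun t ht => ⟨hdet t ht, (hθ t ht).1, hmem t ht, ?_⟩⟩
  · rw [continuousOn_iff_continuous_domRestrict, continuous_iff_continuousAt]
    intro t
    have hcont := (continuousOn_iff_continuous_domRestrict.1
      (hS.continuousOn (gaussState hħ hM))).tendsto t
    refine tendsto_phase_of_tendsto_smul_gaussState hħ (fun s : I => hmem s s.2)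
      (fun s => hnorm s s.2) (hmem t t.2) (hnorm t t.2) ?_
    rw [Set.domRestrict_apply, (hθ t t.2).2] at hcont
    exact hcont.congr fun s => (hθ s s.2).2
  -- `α(S_0)M` is generalized to `N` because the state depends on a proof that its matrix lies in
  -- `siegel n`; the phase is then `1` since the Gaussian is nonzero.
  · have key : ∀ (N : Matrix (Fin n) (Fin n) ℂ) (hN : N ∈ siegel n), N = M →
        gaussState hħ hM = θ 0 • gaussState hħ hN → θ 0 = 1 := by
      rintro N hN rfl h
      have h' : (1 - θ 0) • gaussState hħ hN = 0 := by
        rw [sub_smul, one_smul, ← h, sub_self]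
      rcases smul_eq_zero.1 h' with h1 | h1
      · exact (sub_eq_zero.1 h1).symm
      · exact absurd h1 (gaussState_ne_zero hħ hN)
    refine key _ (hmem 0 h0) (by rw [flowJacobian_zero hf h0, siegelAction_one]) ?_
    rw [← (hθ 0 h0).2, hS.map_zero]
    rfl
  · have hinv : (heisenbergWeyl ħ z₀)⁻¹ (squeezedState hħ z₀ hM) = gaussState hħ hM :=
      (heisenbergWeyl ħ z₀).symm_apply_apply _
    rw [nearbyOrbitPropagator, hinv, (hθ t ht).2, map_smul]
    rfl
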